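/- Let $\Phi^a$ be a simply laced affine root system (all of whose irreducible components are of types $A_n^{(1)},D_n^{(1)},E_n^{(1)}$), with simple roots $\Delta^a=\{\alpha_i\}_{i}$ and symmetric Cartan matrix $C$. For an irreducible component $c$ let $\delta_c=\sum_{i\in c}\mathfrak m_i\alpha_i$ be its primitive positive imaginary root. Let $W^{ae}=P\rtimes W$ be the extended affine Weyl group, i.e. the group of automorphisms of the lattice $\bigoplus_i\mathbb Z\alpha_i$ generated by the simple reflections $s_i$ and the translations $t_\lambda:\alpha_i\mapsto\alpha_i-(\lambda,\alpha_i)\delta_c$ ($i\in c$) by weights $\lambda\in P$. Let $\mathcal A$ be the set of tuples $\vec a=(a_i)_i$ of nonzero complex numbers such that $q=\prod_{i\in c}a_i^{\mathfrak m_i}$ is the same for all components $c$. To $\alpha=\sum k_i\alpha_i$ one assigns the root variable $a_\alpha=\prod a_i^{k_i}$, and $W^{ae}$ acts on $\mathcal A$ by $w(\vec a)_i=a_{w^{-1}\alpha_i}$; thus $s_i(a_j)=a_ja_i^{-C_{ij}}$. Let $\widehat\Omega\subset W^{ae}$ be the subgroup preserving the closed fundamental alcove $\{x\in\mathbb R^{\Delta^a}:\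 x_i\ge 0 \text{ for all } i,\ \sum_{i\in c}\mathfrak m_ix_i=1\text{ for all }c\}$, and for $I\subset\Delta^a$ let $\widehat\Omega_I\subset\widehat\Omega$ be the subgroup preserving $I$. For a finite irreducible root system $\Phi$ with chosen simple roots, let $\Omega_\Phi$ be the subgroup of those elements of its Weyl group that map the fundamental alcove of $\Phi$ to a translate of itself. Let $\vec a\in\mathcal A$ with $|q|\ne1$. Then there exist $I\subset\Delta^a$ and $g\in W^{ae}$ with the following properties. Let $\Phi_1,\dots,\Phi_l$ be the root systems whose simple roots are the connected components of the full subgraph of the affine Dynkin diagram on the vertex set $I$; they are finite. Put $\vec a''=g(\vec a)$ and let $W^o_j$ be the group generated by the reflections in those roots of $\Phi_j$ whose root variable with respect to $\vec a''$ equals $1$. Then the stabilizer of $\vec a''$ in $W^{ae}$ is an internal semidirect product $$W^{ae}_{\vec a''}=\Omega_{[\vec a]}\ltimes\prod_{j=1}^l W^o_j,$$ where $\Omega_{[\vec a]}$ is some subgroup of the (internal semidirect) product $\widehat\Omega_I\ltimes\prod_{j=1}^l\Omega_{\Phi_j}\subset W^{ae}$. -/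

import Mathlib

/-!
Simply laced affine root systems, their extended affine Weyl groups, and the action of these
groups on multiplicative root variables.

The affine simple roots `Δ^a` are indexed by a finite type `ι`, `C` is the affine Cartan matrix and
`m` the marks. The affine root system is allowed to be reducible; then `Δ^a` is the disjoint union
of the affine diagrams of its components. The lattice spanned by the simple roots is `ι → ℤ`.
-/

noncomputable section

open scoped Pointwise

namespace AffineStab

section Products

variable {G : Type*} [Group G]

/-- `K` is the internal direct product of the family of subgroups `H j`. -/
structure IsInternalProd {κ : Type*} (H : κ → Subgroup G) (K : Subgroup G) : Prop where
  commute : ∀ i j, i ≠ j → ∀ x ∈ H i, ∀ y ∈ H j, Commute x y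
  indep : iSupIndep H
  iSup_eq : ⨆ j, H j = K

/-- `K` is the internal semidirect product `H ⋉ N` with `N` normal in `K`. -/
structure IsInternalSemidirect (H N K : Subgroup G) : Prop where
  normalizes : ∀ h ∈ H, ∀ n ∈ N, h * n * h⁻¹ ∈ N
  disjoint : Disjoint H N
  sup_eq : H ⊔ N = K

end Products

variable {ι : Type*} [Fintype ι] [DecidableEq ι]

/-- The graph of the Dynkin diagram with Cartan matrix `C`. -/
def dynkin (C : Matrix ι ι ℤ) : SimpleGraph ι :=
  SimpleGraph.fromRel fun i j => C i j ≠ 0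

/-- The imaginary root `δ = ∑ mᵢ αᵢ` of a connected component `c` of the affine diagram. -/
def delta (C : Matrix ι ι ℤ) (m : ι → ℕ) (c : (dynkin C).ConnectedComponent) : ι → ℤ :=
  open Classical in fun i => if (dynkin C).connectedComponentMk i = c then (m i : ℤ) else 0

/-- `C` is the Cartan matrix of a simply laced affine root system with marks `m`: a symmetric
generalized Cartan matrix, each indecomposable block of which is of affine type, i.e. has a positive
null vector. The marks of a block are its primitive positive integral null vector. -/
structure IsSimplyLacedAffine (C : Matrix ι ι ℤ) (m : ι → ℕ) : Prop where
  symm : C.IsSymm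
  diag : ∀ i, C i i = 2
  offDiag : ∀ i j, i ≠ j → C i j ≤ 0
  marks_pos : ∀ i, 0 < m i
  marks_null : ∀ i, ∑ j, C i j * (m j : ℤ) = 0
  marks_primitive : ∀ (c : (dynkin C).ConnectedComponent) (d : ℕ),
    (∀ i, (dynkin C).connectedComponentMk i = c → d ∣ m i) → d = 1

/-- The simple root `αᵢ`. -/
def simpleRoot (i : ι) : ι → ℤ := Pi.single i 1

/-- The invariant bilinear form, `(αᵢ, αⱼ) = Cᵢⱼ`. -/
def form (C : Matrix ι ι ℤ) (u v : ι → ℤ) : ℤ := ∑ i, ∑ j, u i * C i j * v j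

/-- The automorphism group of the lattice spanned by the simple roots. -/
abbrev LatAut (ι : Type*) := (ι → ℤ) ≃ₗ[ℤ] (ι → ℤ)

/-- The reflections `s_β : v ↦ v - (v, β) β` in the elements `β` of a set `S` of roots
(all roots have `(β, β) = 2`). -/
def reflections (C : Matrix ι ι ℤ) (S : Set (ι → ℤ)) : Set (LatAut ι) :=
  {s | ∃ β ∈ S, ∀ v, s v = v - form C v β • β}

/-- The translations `t_lam`, acting on simple roots by `αᵢ ↦ αᵢ - (lam, αᵢ) δ`. The weight `lam` is
given by the integers `(lam, αᵢ)`, subject only to `(lam, δ) = 0` for each component. -/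
def translations (C : Matrix ι ι ℤ) (m : ι → ℕ) : Set (LatAut ι) :=
  {t | ∃ lam : ι → ℤ, (∀ c, ∑ i, lam i * delta C m c i = 0) ∧
    ∀ i, t (simpleRoot i) =
      simpleRoot i - lam i • delta C m ((dynkin C).connectedComponentMk i)}

/-- The extended affine Weyl group `W^{ae} = P ⋊ W`, generated by the simple reflections and the
translations by weights. -/
def extWeyl (C : Matrix ι ι ℤ) (m : ι → ℕ) : Subgroup (LatAut ι) :=
  Subgroup.closure (reflections C (Set.range simpleRoot) ∪ translations C m)

/-- The group generated by the simple reflections `s_i`, `i ∈ J`. -/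
def parabolic (C : Matrix ι ι ℤ) (J : Set ι) : Subgroup (LatAut ι) :=
  Subgroup.closure (reflections C (simpleRoot '' J))

/-- The root system with simple roots `αⱼ`, `j ∈ J`. -/
def subRoots (C : Matrix ι ι ℤ) (J : Set ι) : Set (ι → ℤ) :=
  {β | ∃ w ∈ parabolic C J, ∃ j ∈ J, β = w (simpleRoot j)}

/-! ### Root variables -/

/-- The multiplicative root variable `∏ aᵢ ^ kᵢ` of `∑ kᵢ αᵢ`. -/
def rootVar (a : ι → ℂˣ) (k : ι → ℤ) : ℂˣ := ∏ i, a i ^ k i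

/-- The action on tuples of root variables, `w(a)_i = a_{w⁻¹ αᵢ}`. For simple reflections this is
`s_i(a)_j = a_j a_i^{-C_ij}`, for translations `t_lam(a)_i = q^{(lam, αᵢ)} a_i`. -/
def act (w : LatAut ι) (a : ι → ℂˣ) : ι → ℂˣ := fun i => rootVar a (w⁻¹ (simpleRoot i))

theorem rootVar_simpleRoot (a : ι → ℂˣ) (i : ι) : rootVar a (simpleRoot i) = a i := by
  unfold rootVar simpleRoot
  rw [Finset.prod_eq_single i]
  · simp
  · intro j _ hj
    simp [hj]
  · simp

theorem rootVar_act (w : LatAut ι) (a : ι → ℂˣ) (v : ι → ℤ) :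
    rootVar (act w a) v = rootVar a (w⁻¹ v) := by
  let f (b : ι → ℂˣ) : (ι → ℤ) →+ Additive ℂˣ :=
    { toFun := fun k => Additive.ofMul (rootVar b k)
      map_zero' := by simp [rootVar]
      map_add' := fun x y => by simp [rootVar, zpow_add, Finset.prod_mul_distrib] }
  have h : f (act w a) = (f a).comp (w⁻¹ : LatAut ι).toLinearMap.toAddMonoidHom := by
    refine AddMonoidHom.functions_ext' _ _ _ fun i => AddMonoidHom.ext_int ?_
    change Additive.ofMul (rootVar (act w a) (simpleRoot i)) =
      Additive.ofMul (rootVar a (w⁻¹ (simpleRoot i)))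
    rw [rootVar_simpleRoot]
    rfl
  exact congrArg Additive.toMul (DFunLike.congr_fun h v)

theorem act_one (a : ι → ℂˣ) : act 1 a = a :=
  funext fun i => by simp [act, rootVar_simpleRoot]

theorem act_mul (w w' : LatAut ι) (a : ι → ℂˣ) : act (w * w') a = act w (act w' a) := by
  funext i
  change rootVar a ((w * w')⁻¹ (simpleRoot i)) = rootVar (act w' a) (w⁻¹ (simpleRoot i))
  rw [rootVar_act, mul_inv_rev]
  rfl

/-- The stabilizer of `a` in `W^{ae}`. -/
def stab (C : Matrix ι ι ℤ) (m : ι → ℕ) (a : ι → ℂˣ) : Subgroup (LatAut ι) where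
  carrier := {w | w ∈ extWeyl C m ∧ act w a = a}
  one_mem' := ⟨one_mem _, act_one a⟩
  mul_mem' := fun {x y} hx hy => ⟨mul_mem hx.1 hy.1, by rw [act_mul, hy.2, hx.2]⟩
  inv_mem' := fun {x} hx => ⟨inv_mem hx.1, by
    conv_lhs => rw [← hx.2]
    rw [← act_mul, inv_mul_cancel, act_one]⟩

/-- `W^o` for the root system with simple roots in `J`: the group generated by the reflections in
those of its roots whose root variable equals `1`. -/
def unitReflGroup (C : Matrix ι ι ℤ) (a : ι → ℂˣ) (J : Set ι) : Subgroup (LatAut ι) :=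
  Subgroup.closure (reflections C {β | β ∈ subRoots C J ∧ rootVar a β = 1})

/-! ### Alcoves -/

/-- The value of `∑ kᵢ αᵢ` at the point with coordinates `xᵢ`. -/
def evalR (x : ι → ℝ) (k : ι → ℤ) : ℝ := ∑ i, (k i : ℝ) * x i

/-- The action on points, dual to the action on the lattice: `w(x)_i = (w⁻¹ αᵢ)(x)`. -/
def actR (w : LatAut ι) (x : ι → ℝ) : ι → ℝ := fun i => evalR x (w⁻¹ (simpleRoot i))

theorem evalR_simpleRoot (x : ι → ℝ) (i : ι) : evalR x (simpleRoot i) = x i := by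
  unfold evalR simpleRoot
  rw [Finset.sum_eq_single i]
  · simp
  · intro j _ hj
    simp [hj]
  · simp

theorem evalR_actR (w : LatAut ι) (x : ι → ℝ) (v : ι → ℤ) :
    evalR (actR w x) v = evalR x (w⁻¹ v) := by
  let f (b : ι → ℝ) : (ι → ℤ) →+ ℝ :=
    { toFun := evalR b
      map_zero' := by simp [evalR]
      map_add' := fun x y => by simp [evalR, add_mul, Finset.sum_add_distrib] }
  have h : f (actR w x) = (f x).comp (w⁻¹ : LatAut ι).toLinearMap.toAddMonoidHom := by
    refine AddMonoidHom.functions_ext' _ _ _ fun i => AddMonoidHom.ext_int ?_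
    change evalR (actR w x) (simpleRoot i) = evalR x (w⁻¹ (simpleRoot i))
    rw [evalR_simpleRoot]
    rfl
  exact DFunLike.congr_fun h v

theorem actR_one (x : ι → ℝ) : actR 1 x = x :=
  funext fun i => by simp [actR, evalR_simpleRoot]

theorem actR_mul (w w' : LatAut ι) (x : ι → ℝ) : actR (w * w') x = actR w (actR w' x) := by
  funext i
  change evalR x ((w * w')⁻¹ (simpleRoot i)) = evalR (actR w' x) (w⁻¹ (simpleRoot i))
  rw [evalR_actR, mul_inv_rev]
  rfl

theorem actR_add (w : LatAut ι) (x y : ι → ℝ) : actR w (x + y) = actR w x + actR w y := by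
  funext i
  simp [actR, evalR, mul_add, Finset.sum_add_distrib]

theorem actR_image_image (w w' : LatAut ι) (S : Set (ι → ℝ)) :
    actR w '' (actR w' '' S) = actR (w * w') '' S := by
  rw [Set.image_image]
  simp only [actR_mul]

theorem actR_image_one (S : Set (ι → ℝ)) : actR (1 : LatAut ι) '' S = S := by
  simp only [funext actR_one, Set.image_id']

theorem actR_image_vadd (w : LatAut ι) (v : ι → ℝ) (S : Set (ι → ℝ)) :
    actR w '' (v +ᵥ S) = actR w v +ᵥ actR w '' S := by
  ext y
  simp only [Set.mem_image, Set.mem_vadd_set, vadd_eq_add]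
  constructor
  · rintro ⟨_, ⟨s, hs, rfl⟩, rfl⟩
    exact ⟨_, ⟨s, hs, rfl⟩, (actR_add w v s).symm⟩
  · rintro ⟨_, ⟨s, hs, rfl⟩, rfl⟩
    exact ⟨_, ⟨s, hs, rfl⟩, actR_add w v s⟩

/-- The closed fundamental alcove. The space on which `W^{ae}` acts by affine transformations is
the space of points with `δ(x) = 1` (for each component); the coordinate of an affine root `α₀` is
thus `1` minus the value of the highest root. -/
def alcove (C : Matrix ι ι ℤ) (m : ι → ℕ) : Set (ι → ℝ) :=
  {x | (∀ c, evalR x (delta C m c) = 1) ∧ ∀ i, 0 ≤ x i}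

/-- `Ω̂`, the subgroup of `W^{ae}` preserving the fundamental alcove. -/
def omegaHat (C : Matrix ι ι ℤ) (m : ι → ℕ) : Subgroup (LatAut ι) where
  carrier := {w | w ∈ extWeyl C m ∧ actR w '' alcove C m = alcove C m}
  one_mem' := ⟨one_mem _, actR_image_one _⟩
  mul_mem' := fun {x y} hx hy => ⟨mul_mem hx.1 hy.1, by rw [← actR_image_image, hy.2, hx.2]⟩
  inv_mem' := fun {x} hx => ⟨inv_mem hx.1, by
    conv_lhs => rw [← hx.2]
    rw [actR_image_image, inv_mul_cancel, actR_image_one]⟩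

/-- `Ω̂_I`, the subgroup of `Ω̂` preserving the set `I` of simple roots. -/
def omegaHatSub (C : Matrix ι ι ℤ) (m : ι → ℕ) (I : Set ι) : Subgroup (LatAut ι) :=
  omegaHat C m ⊓ MulAction.stabilizer (LatAut ι) (simpleRoot '' I : Set (ι → ℤ))

/-- The closed fundamental alcove of the finite root system `Φ` with simple roots in `J`: simple
roots are nonnegative and every root (equivalently, the highest root) is at most `1`. The space of
`Φ` has the coordinates `xⱼ`, `j ∈ J`; the set here is the preimage of the alcove under the
projection from `ι → ℝ` to that space, which commutes with the action of the Weyl group of `Φ`. -/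
def subAlcove (C : Matrix ι ι ℤ) (J : Set ι) : Set (ι → ℝ) :=
  {x | (∀ j ∈ J, 0 ≤ x j) ∧ ∀ β ∈ subRoots C J, evalR x β ≤ 1}

/-- `Ω_Φ` for the finite root system `Φ` with simple roots in `J`: the subgroup of its Weyl group
of the elements which map the fundamental alcove to a parallel one, i.e. to a translate of it. -/
def omegaFin (C : Matrix ι ι ℤ) (J : Set ι) : Subgroup (LatAut ι) where
  carrier := {w | w ∈ parabolic C J ∧
    ∃ v : ι → ℝ, actR w '' subAlcove C J = v +ᵥ subAlcove C J}
  one_mem' := ⟨one_mem _, 0, by rw [actR_image_one, zero_vadd]⟩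
  mul_mem' := by
    rintro x y ⟨hx, v, hv⟩ ⟨hy, u, hu⟩
    refine ⟨mul_mem hx hy, actR x u + v, ?_⟩
    rw [← actR_image_image, hu, actR_image_vadd, hv, vadd_vadd]
  inv_mem' := by
    rintro x ⟨hx, v, hv⟩
    refine ⟨inv_mem hx, -actR x⁻¹ v, ?_⟩
    have h : actR x⁻¹ v +ᵥ actR x⁻¹ '' subAlcove C J = subAlcove C J := by
      rw [← actR_image_vadd, ← hv, actR_image_image, inv_mul_cancel, actR_image_one]
    rw [eq_neg_vadd_iff.mpr h]

/-- The connected components of the subgraph of the affine diagram with vertex set `I`. -/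
abbrev Comp (C : Matrix ι ι ℤ) (I : Set ι) : Type _ :=
  ((dynkin C).induce I).ConnectedComponent

/-- The vertex set of a component. -/
def Comp.verts {C : Matrix ι ι ℤ} {I : Set ι} (j : Comp C I) : Set ι := Subtype.val '' j.supp

end AffineStab

end

noncomputable section

open scoped Pointwise

namespace AffineStab

set_option linter.unusedSectionVars false

variable {ι : Type*} [Fintype ι] [DecidableEq ι] {C : Matrix ι ι ℤ} {m : ι → ℕ}

/-! ### The form and the pairing with points -/

/-! Write |a_i| = |q|^{x_i} and arg a_i = 2π y_i. The variable of a lattice vector is 1 exactly when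
the vector vanishes at x and is integral at y (`isPolar_log_arg`). Since |q| ≠ 1, the point x is
defined and satisfies δ(x) = 1 for every component. Stabilizing the tuple thus means fixing x, and
fixing y modulo integers.

Both points are first put in normal position. Simple reflections bring x into the fundamental alcove
(`exists_actR_nonneg`); I is the set of its zero coordinates. The real roots vanishing at x are
those supported in I (`mem_rootsIn_of_eval_eq_zero`), and they form a finite system because δ(x) = 1
prevents I from containing a whole component. The group W_I fixes x, so it remains available to move
y, modulo integers, into the closed alcove of this finite system (`exists_alcove_representative`).

The roots supported in I with variable 1 are those integral at y; their reflections generate a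
normal subgroup of the stabilizer. If p is interior to the alcove then p - y vanishes on none of
them, so it defines a positive system. The complement consists of the stabilizer elements preserving
that system (`posStab`). Simple transitivity of a reflection group on its positive systems
(`IsFiniteLaced.exists_mul_pos`, `IsFiniteLaced.eq_one_of_pos`) gives the semidirect product
(`isInternalSemidirect_stab`).

An element w of the complement fixes x, hence w = ωu with ω in `omegaHatSub` and u in W_I
(`exists_omegaHat_mul_parabolic`). As y lies in the closed alcove and w respects the signs of p - y,
for positive β the values y(w⁻¹β) and y(β) agree if w⁻¹β is positive, and y(w⁻¹β) = y(β) - 1 if it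
is negative (`evalR_inv_apply_of_mem_posStab`). This is the condition for each component of u to
translate the alcove of its Φ_j (`mem_omegaFin_of_shift`). -/

theorem form_add_left (u u' v : ι → ℤ) : form C (u + u') v = form C u v + form C u' v := by
  simp [form, add_mul, Finset.sum_add_distrib]

theorem form_smul_left (k : ℤ) (u v : ι → ℤ) : form C (k • u) v = k * form C u v := by
  simp [form, Finset.mul_sum, mul_assoc]

theorem form_neg_left (u v : ι → ℤ) : form C (-u) v = -form C u v := by
  simp [form]

theorem form_sub_left (u u' v : ι → ℤ) : form C (u - u') v = form C u v - form C u' v := by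
  simp [form, sub_mul, Finset.sum_sub_distrib]

theorem form_add_right (u v v' : ι → ℤ) : form C u (v + v') = form C u v + form C u v' := by
  simp [form, mul_add, Finset.sum_add_distrib]

theorem form_smul_right (k : ℤ) (u v : ι → ℤ) : form C u (k • v) = k * form C u v := by
  simp [form, Finset.mul_sum, mul_left_comm]

theorem form_neg_right (u v : ι → ℤ) : form C u (-v) = -form C u v := by
  simp [form]

theorem form_sub_right (u v v' : ι → ℤ) : form C u (v - v') = form C u v - form C u v' := by
  simp [form, mul_sub, Finset.sum_sub_distrib]

theorem form_comm (hC : C.IsSymm) (u v : ι → ℤ) : form C u v = form C v u := by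
  unfold form
  rw [Finset.sum_comm]
  refine Finset.sum_congr rfl fun i _ => Finset.sum_congr rfl fun j _ => ?_
  rw [← hC.apply i j]
  ring

theorem form_simpleRoot_right (u : ι → ℤ) (i : ι) :
    form C u (simpleRoot i) = ∑ j, u j * C j i := by
  simp [form, simpleRoot, Pi.single_apply]

theorem form_simpleRoot (i j : ι) : form C (simpleRoot i) (simpleRoot j) = C i j := by
  rw [form_simpleRoot_right]
  simp [simpleRoot, Pi.single_apply]

theorem form_eq_sum (u v : ι → ℤ) : form C u v = ∑ i, form C u (simpleRoot i) * v i := by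
  simp only [form_simpleRoot_right, Finset.sum_mul]
  exact Finset.sum_comm

theorem evalR_add (x : ι → ℝ) (u v : ι → ℤ) : evalR x (u + v) = evalR x u + evalR x v := by
  simp [evalR, add_mul, Finset.sum_add_distrib]

theorem evalR_sub (x : ι → ℝ) (u v : ι → ℤ) : evalR x (u - v) = evalR x u - evalR x v := by
  simp [evalR, sub_mul, Finset.sum_sub_distrib]

theorem evalR_neg (x : ι → ℝ) (u : ι → ℤ) : evalR x (-u) = -evalR x u := by
  simp [evalR]

theorem evalR_zsmul (x : ι → ℝ) (k : ℤ) (u : ι → ℤ) : evalR x (k • u) = k * evalR x u := by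
  simp [evalR, Finset.mul_sum, mul_assoc]

theorem evalR_sub_left (x y : ι → ℝ) (u : ι → ℤ) : evalR (x - y) u = evalR x u - evalR y u := by
  simp [evalR, mul_sub, Finset.sum_sub_distrib]

theorem evalR_nonneg {x : ι → ℝ} {u : ι → ℤ} (hx : ∀ i, 0 ≤ x i) (hu : 0 ≤ u) :
    0 ≤ evalR x u :=
  Finset.sum_nonneg fun i _ => mul_nonneg (by exact_mod_cast hu i) (hx i)

/-! ### Reflections -/

/-- The reflection in `β`, which is trivial unless `(β, β) = 2`. -/
def reflection (C : Matrix ι ι ℤ) (β : ι → ℤ) : LatAut ι :=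
  if h : form C β β = 2 then
    LinearEquiv.ofInvolutive
      { toFun := fun v => v - form C v β • β
        map_add' := fun u v => by rw [form_add_left]; module
        map_smul' := fun k v => by rw [form_smul_left, RingHom.id_apply]; module }
      fun v => by
        change v - form C v β • β - form C (v - form C v β • β) β • β = v
        rw [form_sub_left, form_smul_left, h]
        module
  else 1

theorem reflection_apply {β : ι → ℤ} (h : form C β β = 2) (v : ι → ℤ) :
    reflection C β v = v - form C v β • β := by
  rw [reflection, dif_pos h]
  rfl

theorem reflection_self {β : ι → ℤ} (h : form C β β = 2) : reflection C β β = -β := by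
  rw [reflection_apply h, h]
  module

theorem reflection_mul_self {β : ι → ℤ} (h : form C β β = 2) :
    reflection C β * reflection C β = 1 := by
  refine LinearEquiv.ext fun v => ?_
  change reflection C β (reflection C β v) = v
  simp only [reflection_apply h, form_sub_left, form_smul_left, h]
  module

theorem reflection_reflection {β : ι → ℤ} (h : form C β β = 2) (v : ι → ℤ) :
    reflection C β (reflection C β v) = v :=
  LinearEquiv.congr_fun (reflection_mul_self h) v

theorem reflection_inv {β : ι → ℤ} (h : form C β β = 2) :
    (reflection C β)⁻¹ = reflection C β :=
  inv_eq_of_mul_eq_one_left (reflection_mul_self h)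

theorem reflection_neg {β : ι → ℤ} (h : form C β β = 2) :
    reflection C (-β) = reflection C β := by
  refine LinearEquiv.ext fun v => ?_
  rw [reflection_apply h, reflection_apply (by rw [form_neg_left, form_neg_right, neg_neg, h]),
    form_neg_right]
  module

theorem mem_reflections_iff {S : Set (ι → ℤ)} (hS : ∀ β ∈ S, form C β β = 2) {s : LatAut ι} :
    s ∈ reflections C S ↔ ∃ β ∈ S, s = reflection C β := by
  refine exists_congr fun β => and_congr_right fun hβ => ?_
  rw [LinearEquiv.ext_iff]
  simp only [reflection_apply (hS β hβ)]

/-- The automorphism `w` preserves the form. -/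
def PreservesForm (C : Matrix ι ι ℤ) (w : LatAut ι) : Prop :=
  ∀ u v, form C (w u) (w v) = form C u v

theorem PreservesForm.mul {w w' : LatAut ι} (h : PreservesForm C w) (h' : PreservesForm C w') :
    PreservesForm C (w * w') := fun u v => (h _ _).trans (h' u v)

theorem PreservesForm.inv {w : LatAut ι} (h : PreservesForm C w) : PreservesForm C w⁻¹ := by
  intro u v
  rw [← h]
  congr 1 <;> exact LinearEquiv.apply_symm_apply _ _

theorem preservesForm_reflection (hC : C.IsSymm) {β : ι → ℤ} (h : form C β β = 2) :
    PreservesForm C (reflection C β) := by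
  intro u v
  simp only [reflection_apply h, form_sub_left, form_sub_right, form_smul_left, form_smul_right, h,
    form_comm hC β v]
  ring

theorem conj_reflection {w : LatAut ι} (hw : PreservesForm C w) {β : ι → ℤ}
    (h : form C β β = 2) : w * reflection C β * w⁻¹ = reflection C (w β) := by
  refine LinearEquiv.ext fun v => ?_
  obtain ⟨u, rfl⟩ := w.surjective v
  rw [reflection_apply (by rw [hw, h]), hw]
  change w (reflection C β (w.symm (w u))) = _
  rw [LinearEquiv.symm_apply_apply, reflection_apply h, map_sub, map_zsmul]

/-- The group generated by the reflections in the elements of `R`. -/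
def reflGroup (C : Matrix ι ι ℤ) (R : Set (ι → ℤ)) : Subgroup (LatAut ι) :=
  Subgroup.closure (reflections C R)

theorem reflection_mem_reflGroup {R : Set (ι → ℤ)} {β : ι → ℤ} (hβ : β ∈ R)
    (h : form C β β = 2) : reflection C β ∈ reflGroup C R :=
  Subgroup.subset_closure ⟨β, hβ, reflection_apply h⟩

theorem reflGroup_le {R : Set (ι → ℤ)} (hR : ∀ β ∈ R, form C β β = 2) {H : Subgroup (LatAut ι)}
    (h : ∀ β ∈ R, reflection C β ∈ H) : reflGroup C R ≤ H := by
  refine (Subgroup.closure_le H).2 fun s hs => ?_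
  obtain ⟨β, hβ, rfl⟩ := (mem_reflections_iff hR).1 hs
  exact h β hβ

theorem conj_mem_reflGroup {R S : Set (ι → ℤ)} (hR : ∀ β ∈ R, form C β β = 2) {w : LatAut ι}
    (hw : PreservesForm C w) (h : ∀ β ∈ R, w β ∈ S) {n : LatAut ι} (hn : n ∈ reflGroup C R) :
    w * n * w⁻¹ ∈ reflGroup C S := by
  have : reflGroup C R ≤ (reflGroup C S).comap (MulAut.conj w).toMonoidHom := by
    refine reflGroup_le hR fun β hβ => ?_
    change w * reflection C β * w⁻¹ ∈ reflGroup C S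
    rw [conj_reflection hw (hR β hβ)]
    exact reflection_mem_reflGroup (h β hβ) (by rw [hw, hR β hβ])
  exact this hn

theorem preservesForm_of_mem_reflGroup (hC : C.IsSymm) {R : Set (ι → ℤ)}
    (hR : ∀ β ∈ R, form C β β = 2) {w : LatAut ι} (hw : w ∈ reflGroup C R) :
    PreservesForm C w := by
  let H : Subgroup (LatAut ι) :=
    { carrier := {w | PreservesForm C w}
      one_mem' := fun _ _ => rfl
      mul_mem' := PreservesForm.mul
      inv_mem' := PreservesForm.inv }
  exact (reflGroup_le (H := H) hR fun β hβ => preservesForm_reflection hC (hR β hβ)) hw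

/-- The subgroup used carries the condition on inverses too, since an injection of a possibly
infinite S into itself need not be onto. -/
theorem mem_of_mem_reflGroup {R S : Set (ι → ℤ)} (hR : ∀ β ∈ R, form C β β = 2)
    (hS : ∀ β ∈ R, ∀ γ ∈ S, reflection C β γ ∈ S) {w : LatAut ι} (hw : w ∈ reflGroup C R)
    {γ : ι → ℤ} (hγ : γ ∈ S) : w γ ∈ S := by
  let H : Subgroup (LatAut ι) :=
    { carrier := {w | (∀ γ ∈ S, w γ ∈ S) ∧ ∀ γ ∈ S, w⁻¹ γ ∈ S}
      one_mem' := ⟨fun _ h => h, fun _ h => h⟩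
      mul_mem' := fun {w w'} h h' => ⟨fun γ hγ => h.1 _ (h'.1 γ hγ), fun γ hγ => by
        rw [mul_inv_rev]
        exact h'.2 _ (h.2 γ hγ)⟩
      inv_mem' := fun {w} h => ⟨h.2, by rw [inv_inv]; exact h.1⟩ }
  refine ((reflGroup_le (H := H) hR fun β hβ => ⟨hS β hβ, ?_⟩) hw).1 γ hγ
  rw [reflection_inv (hR β hβ)]
  exact hS β hβ

/-! ### Finite simply laced systems of roots -/

/-- A finite set of roots of square length two, stable under its reflections, in which distinct
roots have inner product at most one. -/
structure IsFiniteLaced (C : Matrix ι ι ℤ) (R : Set (ι → ℤ)) : Prop where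
  finite : R.Finite
  norm : ∀ β ∈ R, form C β β = 2
  reflect : ∀ β ∈ R, ∀ γ ∈ R, reflection C β γ ∈ R
  le_one : ∀ β ∈ R, ∀ γ ∈ R, β ≠ γ → form C β γ ≤ 1

/-- A positive root whose reflection permutes the other positive roots, where positivity is that of
the value at `v`. -/
structure IsSimpleFor (C : Matrix ι ι ℤ) (R : Set (ι → ℤ)) (v : ι → ℝ) (α : ι → ℤ) : Prop where
  mem : α ∈ R
  pos : 0 < evalR v α
  reflect_pos : ∀ γ ∈ R, 0 < evalR v γ → γ ≠ α → 0 < evalR v (reflection C α γ)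

namespace IsFiniteLaced

variable {R : Set (ι → ℤ)} {v : ι → ℝ}

theorem neg_mem (hR : IsFiniteLaced C R) {β : ι → ℤ} (hβ : β ∈ R) : -β ∈ R := by
  rw [← reflection_self (hR.norm β hβ)]
  exact hR.reflect β hβ β hβ

/-- Failure of simplicity gives a positive γ ≠ β with s_β γ not positive. Then (γ, β) > 0, so it is
1, and s_β γ = γ - β; the second summand is β - γ. -/
theorem exists_decomposition (hR : IsFiniteLaced C R) (hv : ∀ β ∈ R, evalR v β ≠ 0)
    {β : ι → ℤ} (hβ : β ∈ R) (hpos : 0 < evalR v β)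
    (hns : ¬ IsSimpleFor C R v β) :
    ∃ γ ∈ R, ∃ γ' ∈ R, 0 < evalR v γ ∧ 0 < evalR v γ' ∧ β = γ + γ' := by
  have : ∃ γ ∈ R, 0 < evalR v γ ∧ γ ≠ β ∧ evalR v (reflection C β γ) ≤ 0 := by
    by_contra! h
    exact hns ⟨hβ, hpos, fun γ h1 h2 h3 => h γ h1 h2 h3⟩
  obtain ⟨γ, hγ, hγpos, hne, hle⟩ := this
  have hrefl := reflection_apply (hR.norm β hβ) γ
  have h1 : form C γ β = 1 := by
    refine le_antisymm (hR.le_one γ hγ β hβ hne) ?_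
    by_contra! h0
    have h0' : (form C γ β : ℝ) ≤ 0 := by exact_mod_cast Int.lt_add_one_iff.1 h0
    rw [hrefl, evalR_sub, evalR_zsmul] at hle
    nlinarith
  have hmem : -reflection C β γ ∈ R := hR.neg_mem (hR.reflect β hβ γ hγ)
  refine ⟨γ, hγ, _, hmem, hγpos, ?_, ?_⟩
  · refine lt_of_le_of_ne ?_ (hv _ hmem).symm
    rw [evalR_neg]
    linarith
  · rw [hrefl, h1]
    module

/-- Induction over the positive roots. -/
theorem pos_induction (hR : IsFiniteLaced C R) (hv : ∀ β ∈ R, evalR v β ≠ 0)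
    {p : (ι → ℤ) → Prop} (hsimple : ∀ α, IsSimpleFor C R v α → p α)
    (hadd : ∀ γ ∈ R, ∀ γ' ∈ R, 0 < evalR v γ → 0 < evalR v γ' → γ + γ' ∈ R →
      p γ → p γ' → p (γ + γ'))
    {β : ι → ℤ} (hβ : β ∈ R) (hpos : 0 < evalR v β) : p β := by
  by_contra hp
  have hfin : {β | β ∈ R ∧ 0 < evalR v β ∧ ¬ p β}.Finite := hR.finite.subset fun β h => h.1
  obtain ⟨β, ⟨hβ, hpos, hp⟩, hmin⟩ := Set.exists_min_image _ (evalR v) hfin ⟨β, hβ, hpos, hp⟩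
  by_cases hs : IsSimpleFor C R v β
  · exact hp (hsimple β hs)
  obtain ⟨γ, hγ, γ', hγ', h1, h2, rfl⟩ := hR.exists_decomposition hv hβ hpos hs
  rw [evalR_add] at hmin
  refine hp (hadd γ hγ γ' hγ' h1 h2 hβ ?_ ?_)
  · by_contra h
    linarith [hmin γ ⟨hγ, h1, h⟩]
  · by_contra h
    linarith [hmin γ' ⟨hγ', h2, h⟩]

theorem apply_mem (hR : IsFiniteLaced C R) {w : LatAut ι} (hw : w ∈ reflGroup C R)
    {β : ι → ℤ} (hβ : β ∈ R) : w β ∈ R :=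
  mem_of_mem_reflGroup hR.norm hR.reflect hw hβ

/-- A positive system can be moved to any other by the reflection group. -/
theorem exists_mul_pos (hR : IsFiniteLaced C R) (hv : ∀ β ∈ R, evalR v β ≠ 0)
    {w : LatAut ι} (hw : ∀ β ∈ R, w β ∈ R) :
    ∃ u ∈ reflGroup C R, ∀ β ∈ R, 0 < evalR v β → 0 < evalR v ((w * u) β) := by
  have hfin : ∀ w : LatAut ι, {β | β ∈ R ∧ 0 < evalR v β ∧ evalR v (w β) < 0}.Finite := fun w =>
    hR.finite.subset fun β h => h.1
  induction hn : {β | β ∈ R ∧ 0 < evalR v β ∧ evalR v (w β) < 0}.ncard using Nat.strong_induction_on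
    generalizing w with
  | _ n ih =>
  by_cases h : ∃ α, IsSimpleFor C R v α ∧ evalR v (w α) < 0
  · obtain ⟨α, hα, hneg⟩ := h
    have hα2 := hR.norm α hα.mem
    have hw' : ∀ β ∈ R, (w * reflection C α) β ∈ R := fun β hβ =>
      hw _ (hR.reflect α hα.mem β hβ)
    have hlt : {β | β ∈ R ∧ 0 < evalR v β ∧ evalR v ((w * reflection C α) β) < 0}.ncard < n := by
      rw [← hn, ← Set.ncard_image_of_injective _ (reflection C α).injective]
      refine Set.ncard_lt_ncard ((Set.ssubset_iff_of_subset ?_).2 ⟨α, ⟨hα.mem, hα.pos, hneg⟩, ?_⟩)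
        (hfin w)
      · rintro _ ⟨β, ⟨hβ, hβpos, hβneg⟩, rfl⟩
        refine ⟨hR.reflect α hα.mem β hβ, hα.reflect_pos β hβ hβpos ?_, hβneg⟩
        rintro rfl
        change evalR v (w (reflection C β β)) < 0 at hβneg
        rw [reflection_self hα2, map_neg, evalR_neg] at hβneg
        linarith
      · rintro ⟨β, ⟨hβ, hβpos, -⟩, h⟩
        have : β = -α := by
          rw [← reflection_reflection hα2 β, h, reflection_self hα2]
        rw [this, evalR_neg] at hβpos
        linarith [hα.pos]
    obtain ⟨u, hu, hu'⟩ := ih _ hlt hw' rfl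
    refine ⟨reflection C α * u, mul_mem (reflection_mem_reflGroup hα.mem hα2) hu, ?_⟩
    rwa [← mul_assoc]
  · push Not at h
    refine ⟨1, one_mem _, fun β hβ hpos => ?_⟩
    rw [mul_one]
    refine hR.pos_induction hv (p := fun β => 0 < evalR v (w β)) ?_ ?_ hβ hpos
    · exact fun α hα => lt_of_le_of_ne (h α hα) (hv _ (hw α hα.mem)).symm
    · intro γ _ γ' _ _ _ _ h1 h2
      rw [map_add, evalR_add]
      exact add_pos h1 h2

/-- Simple reflections generate: when γ, γ' and γ + γ' are roots, (γ, γ') = -1, so γ + γ' = s_γ γ'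
and its reflection is a conjugate of s_γ' by s_γ. -/
theorem exists_list_of_mem (hR : IsFiniteLaced C R) (hC : C.IsSymm)
    (hv : ∀ β ∈ R, evalR v β ≠ 0) {w : LatAut ι} (hw : w ∈ reflGroup C R) :
    ∃ l : List (ι → ℤ), (∀ α ∈ l, IsSimpleFor C R v α) ∧ w = (l.map (reflection C)).prod := by
  let H : Subgroup (LatAut ι) :=
    { carrier := {w | ∃ l : List (ι → ℤ), (∀ α ∈ l, IsSimpleFor C R v α) ∧
        w = (l.map (reflection C)).prod}
      one_mem' := ⟨[], by simp, rfl⟩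
      mul_mem' := by
        rintro _ _ ⟨l, hl, rfl⟩ ⟨l', hl', rfl⟩
        refine ⟨l ++ l', fun α hα => ?_, by simp⟩
        exact (List.mem_append.1 hα).elim (hl α) (hl' α)
      inv_mem' := by
        rintro _ ⟨l, hl, rfl⟩
        refine ⟨l.reverse, fun α hα => hl α (List.mem_reverse.1 hα), ?_⟩
        rw [List.prod_inv_reverse, List.map_map, List.map_reverse]
        refine congrArg (fun l => (List.reverse l).prod) (List.map_congr_left fun α hα => ?_)
        exact reflection_inv (hR.norm α (hl α hα).mem) }
  have hpos : ∀ β ∈ R, 0 < evalR v β → reflection C β ∈ H := by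
    intro β hβ hpos
    refine hR.pos_induction hv (p := fun β => reflection C β ∈ H) ?_ ?_ hβ hpos
    · exact fun α hα => ⟨[α], by simpa using hα, by simp⟩
    · intro γ hγ γ' hγ' _ _ hs h1 h2
      have e1 := hR.norm γ hγ
      have e2 := hR.norm γ' hγ'
      have e3 := hR.norm _ hs
      simp only [form_add_left, form_add_right, e1, e2, form_comm hC γ γ'] at e3
      have e4 : γ + γ' = reflection C γ γ' := by
        rw [reflection_apply e1, show form C γ' γ = -1 by linarith]
        module
      rw [e4, ← conj_reflection (preservesForm_reflection hC e1) e2]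
      exact H.mul_mem (H.mul_mem h1 h2) (H.inv_mem h1)
  refine reflGroup_le (H := H) hR.norm (fun β hβ => ?_) hw
  rcases lt_or_gt_of_ne (hv β hβ) with h | h
  · have h2 := hR.norm β hβ
    rw [← reflection_neg h2]
    exact hpos _ (hR.neg_mem hβ) (by rw [evalR_neg]; linarith)
  · exact hpos β hβ h

/-- The exchange condition. -/
theorem exchange (hR : IsFiniteLaced C R) (hC : C.IsSymm) (hv : ∀ β ∈ R, evalR v β ≠ 0)
    {α : ι → ℤ} (hα : IsSimpleFor C R v α) (l : List (ι → ℤ))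
    (hl : ∀ β ∈ l, IsSimpleFor C R v β) (hneg : evalR v ((l.map (reflection C)).prod α) < 0) :
    ∃ l' : List (ι → ℤ), l'.length < l.length ∧ (∀ β ∈ l', IsSimpleFor C R v β) ∧
      (l.map (reflection C)).prod * reflection C α = (l'.map (reflection C)).prod := by
  induction l with
  | nil => exact absurd hneg (not_lt.2 hα.pos.le)
  | cons β t ih =>
    have ht : ∀ γ ∈ t, IsSimpleFor C R v γ := fun γ hγ => hl γ (List.mem_cons_of_mem _ hγ)
    have hβ := hl β List.mem_cons_self
    have hmem : (t.map (reflection C)).prod ∈ reflGroup C R := by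
      refine list_prod_mem fun s hs => ?_
      obtain ⟨γ, hγ, rfl⟩ := List.mem_map.1 hs
      exact reflection_mem_reflGroup (ht γ hγ).mem (hR.norm γ (ht γ hγ).mem)
    set u := (t.map (reflection C)).prod with hu
    have huα : u α ∈ R := hR.apply_mem hmem hα.mem
    rw [List.map_cons, List.prod_cons] at hneg ⊢
    rcases lt_or_gt_of_ne (hv _ huα) with h | h
    · obtain ⟨t', h1, h2, h3⟩ := ih ht h
      refine ⟨β :: t', by simpa using h1, ?_, ?_⟩
      · exact List.forall_mem_cons.2 ⟨hβ, h2⟩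
      · rw [mul_assoc, h3, List.map_cons, List.prod_cons]
    -- The first letter s_β makes the positive root uα negative, and β is the only positive root it
    -- can do this to. Hence s_β u = u s_α and the two letters cancel.
    · have heq : u α = β := by
        by_contra hne
        exact lt_asymm hneg (hβ.reflect_pos _ huα h hne)
      refine ⟨t, by simp, ht, ?_⟩
      have := conj_reflection (preservesForm_of_mem_reflGroup hC hR.norm hmem)
        (hR.norm α hα.mem)
      rw [heq, mul_inv_eq_iff_eq_mul] at this
      rw [← hu, mul_assoc, this, ← mul_assoc, reflection_mul_self (hR.norm β hβ.mem), one_mul]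

/-- An element of the reflection group which preserves a positive system is trivial. -/
theorem eq_one_of_pos (hR : IsFiniteLaced C R) (hC : C.IsSymm) (hv : ∀ β ∈ R, evalR v β ≠ 0)
    {w : LatAut ι} (hw : w ∈ reflGroup C R)
    (hpos : ∀ β ∈ R, 0 < evalR v β → 0 < evalR v (w β)) : w = 1 := by
  obtain ⟨l, hl, rfl⟩ := hR.exists_list_of_mem hC hv hw
  clear hw
  induction hn : l.length using Nat.strong_induction_on generalizing l with
  | _ n ih =>
  rcases List.eq_nil_or_concat l with rfl | ⟨t, α, rfl⟩
  · rfl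
  rw [List.concat_eq_append] at *
  have ht : ∀ γ ∈ t, IsSimpleFor C R v γ := fun γ hγ => hl γ (by simp [hγ])
  have hα : IsSimpleFor C R v α := hl α (by simp)
  -- The whole word keeps its last letter α positive, so the prefix t makes α negative and the
  -- exchange condition yields a shorter word.
  have hneg := hpos α hα.mem hα.pos
  rw [List.map_append, List.prod_append, List.map_singleton, List.prod_singleton] at hneg hpos ⊢
  change 0 < evalR v ((t.map (reflection C)).prod (reflection C α α)) at hneg
  rw [reflection_self (hR.norm α hα.mem), map_neg, evalR_neg, neg_pos] at hneg
  obtain ⟨l', h1, h2, h3⟩ := hR.exchange hC hv hα t ht hneg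
  rw [h3] at hpos ⊢
  refine ih l'.length ?_ l' h2 hpos rfl
  rw [← hn, List.length_append]
  omega

end IsFiniteLaced

/-! ### The form of an affine Cartan matrix -/

theorem same_component {i j : ι} (h : C i j ≠ 0) :
    (dynkin C).connectedComponentMk i = (dynkin C).connectedComponentMk j := by
  by_cases hij : i = j
  · rw [hij]
  · refine SimpleGraph.ConnectedComponent.sound (SimpleGraph.Adj.reachable ?_)
    exact (SimpleGraph.fromRel_adj _ _ _).2 ⟨hij, Or.inl h⟩

theorem IsSimplyLacedAffine.adj_iff (hC : IsSimplyLacedAffine C m) {i j : ι} :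
    (dynkin C).Adj i j ↔ i ≠ j ∧ C i j ≤ -1 := by
  rw [dynkin, SimpleGraph.fromRel_adj, hC.symm.apply i j, or_self]
  refine and_congr_right fun hij => ?_
  have := hC.offDiag i j hij
  omega

theorem form_eq_zero_of_support {u v : ι → ℤ} (h : ∀ i j, u i ≠ 0 → v j ≠ 0 → C i j = 0) :
    form C u v = 0 := by
  refine Finset.sum_eq_zero fun i _ => Finset.sum_eq_zero fun j _ => ?_
  by_cases hu : u i = 0
  · simp [hu]
  by_cases hv : v j = 0
  · simp [hv]
  simp [h i j hu hv]

theorem form_delta (hC : IsSimplyLacedAffine C m) (u : ι → ℤ)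
    (c : (dynkin C).ConnectedComponent) : form C u (delta C m c) = 0 := by
  refine Finset.sum_eq_zero fun i _ => ?_
  simp only [mul_assoc, ← Finset.mul_sum]
  refine mul_eq_zero_of_right _ ?_
  by_cases hi : (dynkin C).connectedComponentMk i = c
  · rw [← hC.marks_null i]
    refine Finset.sum_congr rfl fun j _ => ?_
    by_cases hij : C i j = 0
    · simp [hij]
    · rw [delta, if_pos ((same_component hij).symm.trans hi)]
  · refine Finset.sum_eq_zero fun j _ => ?_
    by_cases hij : C i j = 0
    · simp [hij]
    · rw [delta, if_neg (fun h => hi ((same_component hij).trans h)), mul_zero]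

theorem form_delta_left (hC : IsSimplyLacedAffine C m) (u : ι → ℤ)
    (c : (dynkin C).ConnectedComponent) : form C (delta C m c) u = 0 := by
  rw [form_comm hC.symm, form_delta hC]

/-- The form is a sum of squares because the marks are a null vector. Semidefiniteness, the radical
and all finiteness statements come from this identity. -/
theorem two_mul_form_eq (hC : IsSimplyLacedAffine C m) (v : ι → ℤ) :
    2 * (form C v v : ℝ) =
      ∑ i, ∑ j, -(C i j : ℝ) * m i * m j * ((v i : ℝ) / m i - (v j : ℝ) / m j) ^ 2 := by
  have hm : ∀ i, (m i : ℝ) ≠ 0 := fun i => Nat.cast_ne_zero.2 (hC.marks_pos i).ne'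
  have hnull : ∀ i, ∑ j, (C i j : ℝ) * m j = 0 := fun i => by exact_mod_cast hC.marks_null i
  have h1 : ∑ i, ∑ j, (v i : ℝ) ^ 2 / m i * ((C i j : ℝ) * m j) = 0 := by
    simp_rw [← Finset.mul_sum, hnull, mul_zero, Finset.sum_const_zero]
  have h2 : ∑ i, ∑ j, (v j : ℝ) ^ 2 / m j * ((C j i : ℝ) * m i) = 0 := by
    rw [Finset.sum_comm]
    exact h1
  have h3 : (form C v v : ℝ) = ∑ i, ∑ j, (v i : ℝ) * C i j * v j := by
    simp [form]
  rw [h3, Finset.mul_sum]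
  simp_rw [Finset.mul_sum]
  -- Subtracting the two vanishing sums supplies the pure squares, after which the identity holds
  -- term by term.
  rw [← sub_zero (∑ i, ∑ j, 2 * _), ← h1, ← sub_zero (_ - _), ← h2]
  simp_rw [← Finset.sum_sub_distrib]
  refine Finset.sum_congr rfl fun i _ => Finset.sum_congr rfl fun j _ => ?_
  rw [hC.symm.apply i j]
  have := hm i
  have := hm j
  field_simp
  ring

theorem sq_term_nonneg (hC : IsSimplyLacedAffine C m) (t : ι → ℝ) (i j : ι) :
    0 ≤ -(C i j : ℝ) * m i * m j * (t i - t j) ^ 2 := by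
  by_cases hij : i = j
  · simp [hij]
  · have : (C i j : ℝ) ≤ 0 := by exact_mod_cast hC.offDiag i j hij
    have : 0 ≤ -(C i j : ℝ) := by linarith
    positivity

theorem form_self_nonneg (hC : IsSimplyLacedAffine C m) (v : ι → ℤ) : 0 ≤ form C v v := by
  have := two_mul_form_eq hC v
  have h : 0 ≤ 2 * (form C v v : ℝ) := by
    rw [this]
    exact Finset.sum_nonneg fun i _ => Finset.sum_nonneg fun j _ =>
      sq_term_nonneg hC (fun i => (v i : ℝ) / m i) i j
  exact_mod_cast (by linarith : (0 : ℝ) ≤ form C v v)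

theorem sq_sub_le_of_adj (hC : IsSimplyLacedAffine C m) (v : ι → ℤ) {i j : ι}
    (h : (dynkin C).Adj i j) :
    ((v i : ℝ) / m i - (v j : ℝ) / m j) ^ 2 ≤ 2 * form C v v := by
  obtain ⟨-, hCij⟩ := hC.adj_iff.1 h
  have h1 : (1 : ℝ) ≤ -(C i j : ℝ) := by
    have : (C i j : ℝ) ≤ -1 := by exact_mod_cast hCij
    linarith
  have hi : (1 : ℝ) ≤ m i := by exact_mod_cast hC.marks_pos i
  have hj : (1 : ℝ) ≤ m j := by exact_mod_cast hC.marks_pos j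
  have hle : (1 : ℝ) ≤ -(C i j : ℝ) * m i * m j :=
    one_le_mul_of_one_le_of_one_le (one_le_mul_of_one_le_of_one_le h1 hi) hj
  calc _ ≤ -(C i j : ℝ) * m i * m j * ((v i : ℝ) / m i - (v j : ℝ) / m j) ^ 2 :=
        le_mul_of_one_le_left (sq_nonneg _) hle
    _ ≤ ∑ j, -(C i j : ℝ) * m i * m j * ((v i : ℝ) / m i - (v j : ℝ) / m j) ^ 2 :=
        Finset.single_le_sum (f := fun j => -(C i j : ℝ) * m i * m j *
          ((v i : ℝ) / m i - (v j : ℝ) / m j) ^ 2)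
          (fun j _ => sq_term_nonneg hC (fun i => (v i : ℝ) / m i) i j) (Finset.mem_univ j)
    _ ≤ _ := by
        rw [two_mul_form_eq hC]
        exact Finset.single_le_sum (f := fun i => ∑ j, -(C i j : ℝ) * m i * m j *
          ((v i : ℝ) / m i - (v j : ℝ) / m j) ^ 2)
          (fun i _ => Finset.sum_nonneg fun j _ =>
            sq_term_nonneg hC (fun i => (v i : ℝ) / m i) i j) (Finset.mem_univ i)

/-- Each edge contributes at most |N|, and K is the length of a path from i to j, so it does not
depend on v. The case N = 0 describes the radical; N = 2 fits vectors of square length two. -/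
theorem ratio_bounded (hC : IsSimplyLacedAffine C m) (N : ℝ) {i j : ι}
    (h : (dynkin C).connectedComponentMk i = (dynkin C).connectedComponentMk j) :
    ∃ K : ℕ, ∀ v : ι → ℤ, 2 * (form C v v : ℝ) ≤ N ^ 2 →
      |(v i : ℝ) / m i - (v j : ℝ) / m j| ≤ K * |N| := by
  obtain ⟨p⟩ := SimpleGraph.ConnectedComponent.exact h
  induction p with
  | nil => exact ⟨0, fun v _ => by simp⟩
  | @cons i k j hadj p ih =>
    obtain ⟨K, hK⟩ := ih (SimpleGraph.ConnectedComponent.sound ⟨p⟩)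
    refine ⟨K + 1, fun v hv => ?_⟩
    have h1 := hK v hv
    have h2 : |(v i : ℝ) / m i - (v k : ℝ) / m k| ≤ |N| :=
      sq_le_sq.1 ((sq_sub_le_of_adj hC v hadj).trans hv)
    have h3 := abs_sub_le ((v i : ℝ) / m i) ((v k : ℝ) / m k) ((v j : ℝ) / m j)
    push_cast
    linarith

theorem eq_zero_of_form_eq_zero (hC : IsSimplyLacedAffine C m) {v : ι → ℤ} (h0 : form C v v = 0)
    {i j : ι} (h : (dynkin C).connectedComponentMk i = (dynkin C).connectedComponentMk j)
    (hj : v j = 0) : v i = 0 := by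
  obtain ⟨K, hK⟩ := ratio_bounded hC 0 h
  have := hK v (by simp [h0])
  rw [hj] at this
  have hm : (m i : ℝ) ≠ 0 := Nat.cast_ne_zero.2 (hC.marks_pos i).ne'
  simpa [hm] using this

/-- Modulo 2 the off-diagonal terms cancel in pairs by symmetry, and the diagonal terms carry the
factor 2. -/
theorem even_form_self (hC : IsSimplyLacedAffine C m) (v : ι → ℤ) : Even (form C v v) := by
  rw [← ZMod.intCast_eq_zero_iff_even]
  unfold form
  push_cast
  rw [← Finset.sum_product']
  refine Finset.sum_involution (fun p _ => p.swap) ?_ ?_ (by simp) (by simp)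
  · rintro ⟨i, j⟩ -
    simp only [Prod.swap_prod_mk]
    rw [hC.symm.apply i j, ← CharTwo.add_self_eq_zero ((v i : ZMod 2) * C i j * v j)]
    ring
  · rintro ⟨i, j⟩ - h1 h2
    simp only [Prod.swap_prod_mk, Prod.mk.injEq] at h2
    obtain ⟨rfl, -⟩ := h2
    apply h1
    simp only [hC.diag]
    rw [show ((2 : ℤ) : ZMod 2) = 0 from rfl]
    ring

/-! ### Affine real roots -/

/-- `v` is supported in the component `c`. -/
def SupportedIn (C : Matrix ι ι ℤ) (c : (dynkin C).ConnectedComponent) (v : ι → ℤ) : Prop :=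
  ∀ i, v i ≠ 0 → (dynkin C).connectedComponentMk i = c

/-- The real affine roots. -/
def affRoots (C : Matrix ι ι ℤ) : Set (ι → ℤ) :=
  {β | form C β β = 2 ∧ ∃ c, SupportedIn C c β}

theorem SupportedIn.sub {c : (dynkin C).ConnectedComponent} {u v : ι → ℤ}
    (hu : SupportedIn C c u) (hv : SupportedIn C c v) : SupportedIn C c (u - v) := by
  intro i hi
  by_cases h : u i = 0
  · exact hv i fun h' => hi (by simp [h, h'])
  · exact hu i h

theorem SupportedIn.smul {c : (dynkin C).ConnectedComponent} {u : ι → ℤ} (k : ℤ)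
    (hu : SupportedIn C c u) : SupportedIn C c (k • u) :=
  fun i hi => hu i (right_ne_zero_of_mul hi)

theorem supportedIn_delta (c : (dynkin C).ConnectedComponent) :
    SupportedIn C c (delta C m c) := by
  intro i hi
  by_contra h
  exact hi (if_neg h)

theorem supportedIn_simpleRoot (i : ι) :
    SupportedIn C ((dynkin C).connectedComponentMk i) (simpleRoot i) := by
  intro j hj
  by_cases h : j = i
  · rw [h]
  · exact absurd (by simp [simpleRoot, h]) hj

theorem form_simpleRoot_self (hC : IsSimplyLacedAffine C m) (i : ι) :
    form C (simpleRoot i) (simpleRoot i) = 2 := by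
  rw [form_simpleRoot, hC.diag]

theorem simpleRoot_mem_affRoots (hC : IsSimplyLacedAffine C m) (i : ι) :
    simpleRoot i ∈ affRoots C :=
  ⟨form_simpleRoot_self hC i, _, supportedIn_simpleRoot i⟩

theorem SupportedIn.reflection {c : (dynkin C).ConnectedComponent} {β v : ι → ℤ}
    (hβ : β ∈ affRoots C) (hv : SupportedIn C c v) : SupportedIn C c (reflection C β v) := by
  obtain ⟨h2, d, hd⟩ := hβ
  rw [reflection_apply h2]
  by_cases hcd : c = d
  · subst hcd
    exact hv.sub (hd.smul _)
  · rw [form_eq_zero_of_support, zero_smul, sub_zero]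
    · exact hv
    · intro i j hi hj
      by_contra h
      exact hcd ((hv i hi).symm.trans ((same_component h).trans (hd j hj)))

theorem reflection_mem_affRoots (hC : IsSimplyLacedAffine C m) {β γ : ι → ℤ}
    (hβ : β ∈ affRoots C) (hγ : γ ∈ affRoots C) : reflection C β γ ∈ affRoots C := by
  obtain ⟨h2, c, hc⟩ := hγ
  exact ⟨by rw [preservesForm_reflection hC.symm hβ.1, h2], c, hc.reflection hβ⟩

theorem neg_mem_affRoots {β : ι → ℤ} (hβ : β ∈ affRoots C) : -β ∈ affRoots C := by
  obtain ⟨h2, c, hc⟩ := hβ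
  exact ⟨by rw [form_neg_left, form_neg_right, neg_neg, h2], c, fun i hi => hc i (by simpa using hi)⟩

theorem affRoots_ne_zero {β : ι → ℤ} (hβ : β ∈ affRoots C) : β ≠ 0 := by
  rintro rfl
  have := hβ.1
  simp [form] at this

/-- With mixed signs, β⁺ and β⁻ each vanish somewhere in the component without being zero there, so
neither is in the radical and each has square length at least 2. Since (β⁺, β⁻) ≤ 0, β would have
square length at least 4. -/
theorem nonneg_or_nonpos (hC : IsSimplyLacedAffine C m) {β : ι → ℤ} (hβ : β ∈ affRoots C) :
    0 ≤ β ∨ β ≤ 0 := by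
  by_contra! h
  obtain ⟨h1, h2⟩ := h
  rw [Pi.le_def] at h1 h2
  push Not at h1 h2
  obtain ⟨i, hi⟩ := h1
  obtain ⟨j, hj⟩ := h2
  simp only [Pi.zero_apply] at hi hj
  obtain ⟨h2, c, hc⟩ := hβ
  have hij := (hc i hi.ne).trans (hc j hj.ne').symm
  have hdec : β = β⁺ - β⁻ := (posPart_sub_negPart β).symm
  have hle : form C β⁺ β⁻ ≤ 0 := by
    refine Finset.sum_nonpos fun k _ => Finset.sum_nonpos fun l _ => ?_
    by_cases hkl : k = l
    · subst hkl
      rw [Pi.posPart_apply, Pi.negPart_apply]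
      rcases le_total 0 (β k) with h | h
      · simp [negPart_of_nonneg h]
      · simp [posPart_of_nonpos h]
    · refine mul_nonpos_of_nonpos_of_nonneg (mul_nonpos_of_nonneg_of_nonpos ?_
        (hC.offDiag k l hkl)) ?_
      · rw [Pi.posPart_apply]; exact posPart_nonneg _
      · rw [Pi.negPart_apply]; exact negPart_nonneg _
  have hpos : 2 ≤ form C β⁺ β⁺ := by
    have h0 := form_self_nonneg hC β⁺
    obtain ⟨k, hk⟩ := even_form_self hC β⁺
    by_contra! hlt
    have hz : form C β⁺ β⁺ = 0 := by omega
    have := eq_zero_of_form_eq_zero hC hz hij.symm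
      (by rw [Pi.posPart_apply]; exact posPart_of_nonpos hi.le)
    rw [Pi.posPart_apply, posPart_of_nonneg hj.le] at this
    omega
  have hneg : 2 ≤ form C β⁻ β⁻ := by
    have h0 := form_self_nonneg hC β⁻
    obtain ⟨k, hk⟩ := even_form_self hC β⁻
    by_contra! hlt
    have hz : form C β⁻ β⁻ = 0 := by omega
    have := eq_zero_of_form_eq_zero hC hz hij
      (by rw [Pi.negPart_apply]; exact negPart_of_nonneg hj.le)
    rw [Pi.negPart_apply, negPart_of_nonpos hi.le] at this
    omega
  rw [hdec] at h2
  simp only [form_sub_left, form_sub_right, form_comm hC.symm β⁻ β⁺] at h2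
  omega

theorem eq_simpleRoot_of_support (hC : IsSimplyLacedAffine C m) {β : ι → ℤ}
    (hβ : β ∈ affRoots C) (h0 : 0 ≤ β) {i : ι} (h : ∀ j, j ≠ i → β j = 0) : β = simpleRoot i := by
  have hs : β = β i • simpleRoot i := by
    funext j
    by_cases hj : j = i
    · subst hj; simp [simpleRoot]
    · simp [simpleRoot, hj, h j hj]
  have h2 := hβ.1
  rw [hs, form_smul_left, form_smul_right, form_simpleRoot_self hC] at h2
  have h0i : 0 ≤ β i := h0 i
  have : β i = 1 := by nlinarith
  rw [hs, this, one_smul]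

theorem reflection_simpleRoot_apply_ne (hC : IsSimplyLacedAffine C m) (v : ι → ℤ) {i j : ι}
    (h : j ≠ i) : reflection C (simpleRoot i) v j = v j := by
  rw [reflection_apply (form_simpleRoot_self hC i)]
  simp [simpleRoot, h]

/-- A simple reflection permutes the other positive roots. -/
theorem reflection_simpleRoot_nonneg (hC : IsSimplyLacedAffine C m) {β : ι → ℤ}
    (hβ : β ∈ affRoots C) (h0 : 0 ≤ β) {i : ι} (hne : β ≠ simpleRoot i) :
    0 ≤ reflection C (simpleRoot i) β := by
  have : ∃ j, j ≠ i ∧ β j ≠ 0 := by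
    by_contra! h
    exact hne (eq_simpleRoot_of_support hC hβ h0 h)
  obtain ⟨j, hj, hβj⟩ := this
  refine (nonneg_or_nonpos hC
    (reflection_mem_affRoots hC (simpleRoot_mem_affRoots hC i) hβ)).resolve_right fun h => ?_
  have := h j
  rw [reflection_simpleRoot_apply_ne hC _ hj] at this
  exact hβj (le_antisymm this (h0 j))

theorem finite_affRoots_bounded (hC : IsSimplyLacedAffine C m) (i₀ : ι) (B : ℕ) :
    {β | β ∈ affRoots C ∧ SupportedIn C ((dynkin C).connectedComponentMk i₀) β ∧
      |β i₀| ≤ B}.Finite := by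
  have : ∀ i, ∃ b : ℤ, ∀ β ∈ affRoots C,
      SupportedIn C ((dynkin C).connectedComponentMk i₀) β → |β i₀| ≤ B → |β i| ≤ b := by
    intro i
    by_cases hi : (dynkin C).connectedComponentMk i = (dynkin C).connectedComponentMk i₀
    · obtain ⟨K, hK⟩ := ratio_bounded hC 2 hi
      refine ⟨m i * (2 * K + B), fun β hβ _ hb => ?_⟩
      have h1 := hK β (by rw [hβ.1]; norm_num)
      rw [abs_two] at h1
      have hm0 : (1 : ℝ) ≤ m i₀ := by exact_mod_cast hC.marks_pos i₀
      have hm : (0 : ℝ) < m i := by exact_mod_cast hC.marks_pos i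
      have h2 : |(β i₀ : ℝ) / m i₀| ≤ B := by
        rw [abs_div, Nat.abs_cast]
        have : |(β i₀ : ℝ)| ≤ B := by exact_mod_cast hb
        exact (div_le_self (abs_nonneg _) hm0).trans this
      have h3 : |(β i : ℝ) / m i| ≤ 2 * K + B := by
        have := abs_sub_abs_le_abs_sub ((β i : ℝ) / m i) ((β i₀ : ℝ) / m i₀)
        linarith
      rw [abs_div, Nat.abs_cast, div_le_iff₀ hm] at h3
      have : (|(β i : ℝ)|) ≤ m i * (2 * K + B) := by linarith
      exact_mod_cast this
    · refine ⟨0, fun β _ hs _ => ?_⟩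
      by_contra h
      exact hi (hs i fun h0 => h (by simp [h0]))
  choose b hb using this
  refine (Set.finite_Icc (-b) b).subset ?_
  rintro β ⟨h1, h2, h3⟩
  exact ⟨fun i => (abs_le.1 (hb i β h1 h2 h3)).1, fun i => (abs_le.1 (hb i β h1 h2 h3)).2⟩

/-! ### Properties of the extended affine Weyl group -/

theorem apply_eq_sum (w : LatAut ι) (v : ι → ℤ) : w v = ∑ i, v i • w (simpleRoot i) := by
  have h : v = ∑ i, v i • simpleRoot i := by
    funext j
    simp [simpleRoot, Pi.single_apply]
  conv_lhs => rw [h]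
  simp only [map_sum, map_zsmul]

theorem preservesForm_of_simpleRoot {w : LatAut ι}
    (h : ∀ i j, form C (w (simpleRoot i)) (w (simpleRoot j)) = C i j) : PreservesForm C w := by
  let B : LinearMap.BilinForm ℤ (ι → ℤ) := LinearMap.mk₂ ℤ (form C) form_add_left
    (fun k u v => form_smul_left k u v) form_add_right (fun k u v => form_smul_right k u v)
  have hB : B.compl₁₂ w.toLinearMap w.toLinearMap = B := by
    refine LinearMap.BilinForm.ext_basis (Pi.basisFun ℤ ι) fun i j => ?_
    rw [Pi.basisFun_apply, Pi.basisFun_apply]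
    exact (h i j).trans (form_simpleRoot i j).symm
  exact fun u v => LinearMap.congr_fun₂ hB u v

/-- The properties shared by all elements of the extended affine Weyl group. -/
structure IsAffineAut (C : Matrix ι ι ℤ) (m : ι → ℕ) (w : LatAut ι) : Prop where
  form : PreservesForm C w
  delta : ∀ c, w (delta C m c) = delta C m c
  supp : ∀ c v, SupportedIn C c v → SupportedIn C c (w v)

theorem IsAffineAut.mul {w w' : LatAut ι} (h : IsAffineAut C m w) (h' : IsAffineAut C m w') :
    IsAffineAut C m (w * w') :=
  ⟨h.form.mul h'.form, fun c => (congrArg w (h'.delta c)).trans (h.delta c),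
    fun c v hv => h.supp c _ (h'.supp c v hv)⟩

theorem isAffineAut_reflection (hC : IsSimplyLacedAffine C m) {β : ι → ℤ} (hβ : β ∈ affRoots C) :
    IsAffineAut C m (reflection C β) :=
  ⟨preservesForm_reflection hC.symm hβ.1,
    fun c => by rw [reflection_apply hβ.1, form_delta_left hC, zero_smul, sub_zero],
    fun _ _ hv => hv.reflection hβ⟩

theorem translation_delta {t : LatAut ι} {lam : ι → ℤ}
    (hlam : ∀ c, ∑ i, lam i * delta C m c i = 0)
    (ht : ∀ i, t (simpleRoot i) =
      simpleRoot i - lam i • delta C m ((dynkin C).connectedComponentMk i))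
    (c : (dynkin C).ConnectedComponent) : t (delta C m c) = delta C m c := by
  rw [apply_eq_sum]
  have h : ∀ i, delta C m c i • t (simpleRoot i) =
      delta C m c i • simpleRoot i - (lam i * delta C m c i) • delta C m c := by
    intro i
    rw [ht]
    by_cases hi : delta C m c i = 0
    · simp [hi]
    · rw [supportedIn_delta c i hi, smul_sub, smul_smul, mul_comm]
  rw [Finset.sum_congr rfl fun i _ => h i, Finset.sum_sub_distrib, ← Finset.sum_smul, hlam,
    zero_smul, sub_zero]
  exact (apply_eq_sum 1 (delta C m c)).symm

theorem isAffineAut_translation (hC : IsSimplyLacedAffine C m) {t : LatAut ι}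
    (ht : t ∈ translations C m) : IsAffineAut C m t := by
  obtain ⟨lam, hlam, ht⟩ := ht
  refine ⟨preservesForm_of_simpleRoot fun i j => ?_, translation_delta hlam ht, fun c v hv k hk => ?_⟩
  · simp only [ht, form_sub_left, form_sub_right, form_smul_left, form_smul_right,
      form_delta hC, form_delta_left hC, form_simpleRoot]
    ring
  · by_contra hkc
    apply hk
    rw [apply_eq_sum, Finset.sum_apply]
    refine Finset.sum_eq_zero fun i _ => ?_
    by_cases hi : v i = 0
    · simp [hi]
    have hic := hv i hi
    have h1 : simpleRoot i k = 0 := by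
      by_contra h
      exact hkc ((supportedIn_simpleRoot (C := C) i k h).trans hic)
    have h2 : delta C m c k = 0 := if_neg hkc
    rw [ht, hic]
    simp [h1, h2]

theorem inv_mem_translations {t : LatAut ι} (ht : t ∈ translations C m) :
    t⁻¹ ∈ translations C m := by
  obtain ⟨lam, hlam, ht⟩ := ht
  refine ⟨-lam, fun c => by simp [hlam c], fun i => ?_⟩
  apply t.injective
  have : t (t⁻¹ (simpleRoot i)) = simpleRoot i := LinearEquiv.apply_symm_apply t _
  rw [this, map_sub, map_zsmul, translation_delta hlam ht, ht, Pi.neg_apply]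
  module

theorem isAffineAut_of_mem (hC : IsSimplyLacedAffine C m) {w : LatAut ι}
    (hw : w ∈ extWeyl C m) : IsAffineAut C m w := by
  let H : Subgroup (LatAut ι) :=
    { carrier := {w | IsAffineAut C m w ∧ IsAffineAut C m w⁻¹}
      one_mem' := by
        have : IsAffineAut C m 1 := ⟨fun _ _ => rfl, fun _ => rfl, fun _ _ h => h⟩
        exact ⟨this, by rwa [inv_one]⟩
      mul_mem' := fun {w w'} h h' => ⟨h.1.mul h'.1, by
        rw [mul_inv_rev]
        exact h'.2.mul h.2⟩
      inv_mem' := fun {w} h => ⟨h.2, by rw [inv_inv]; exact h.1⟩ }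
  have : extWeyl C m ≤ H := by
    refine (Subgroup.closure_le H).2 (Set.union_subset ?_ ?_)
    · intro s hs
      have h2 : ∀ β ∈ Set.range (simpleRoot (ι := ι)), form C β β = 2 := by
        rintro _ ⟨i, rfl⟩
        exact form_simpleRoot_self hC i
      obtain ⟨_, ⟨i, rfl⟩, rfl⟩ := (mem_reflections_iff h2).1 hs
      have := isAffineAut_reflection hC (simpleRoot_mem_affRoots hC i)
      exact ⟨this, by rwa [reflection_inv (form_simpleRoot_self hC i)]⟩
    · exact fun t ht => ⟨isAffineAut_translation hC ht,
        isAffineAut_translation hC (inv_mem_translations ht)⟩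
  exact (this hw).1

theorem IsAffineAut.apply_mem {w : LatAut ι} (h : IsAffineAut C m w) {β : ι → ℤ}
    (hβ : β ∈ affRoots C) : w β ∈ affRoots C := by
  obtain ⟨h2, c, hc⟩ := hβ
  exact ⟨by rw [h.form, h2], c, h.supp c β hc⟩

theorem evalR_actR_delta (hC : IsSimplyLacedAffine C m) {w : LatAut ι} (hw : w ∈ extWeyl C m)
    (x : ι → ℝ) (c : (dynkin C).ConnectedComponent) :
    evalR (actR w x) (delta C m c) = evalR x (delta C m c) := by
  rw [evalR_actR, (isAffineAut_of_mem hC (inv_mem hw)).delta]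

theorem simpleReflection_mem_parabolic (hC : IsSimplyLacedAffine C m) {J : Set ι} {i : ι}
    (hi : i ∈ J) : reflection C (simpleRoot i) ∈ parabolic C J :=
  reflection_mem_reflGroup ⟨i, hi, rfl⟩ (form_simpleRoot_self hC i)

theorem parabolic_mono {J K : Set ι} (h : J ⊆ K) : parabolic C J ≤ parabolic C K := by
  refine Subgroup.closure_mono ?_
  rintro s ⟨_, ⟨i, hi, rfl⟩, hs⟩
  exact ⟨_, ⟨i, h hi, rfl⟩, hs⟩

theorem parabolic_le_extWeyl (J : Set ι) : parabolic C J ≤ extWeyl C m := by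
  refine Subgroup.closure_mono (Set.subset_union_of_subset_left ?_ _)
  rintro s ⟨_, ⟨i, hi, rfl⟩, hs⟩
  exact ⟨_, ⟨i, rfl⟩, hs⟩

/-! ### Moving a point to the fundamental alcove -/

/-- Modulo δ a component has finitely many roots, represented by reducing one coordinate modulo its
mark. Adding kδ raises the value at x by k, so only boundedly many k ≥ 0 leave it negative. -/
theorem finite_negative (hC : IsSimplyLacedAffine C m) {x : ι → ℝ}
    (hx : ∀ c, evalR x (delta C m c) = 1) :
    {β | β ∈ affRoots C ∧ 0 ≤ β ∧ evalR x β < 0}.Finite := by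
  have key : ∀ i₀ : ι, {β | β ∈ affRoots C ∧
      SupportedIn C ((dynkin C).connectedComponentMk i₀) β ∧ 0 ≤ β ∧ evalR x β < 0}.Finite := by
    intro i₀
    set c := (dynkin C).connectedComponentMk i₀ with hc
    have hF := finite_affRoots_bounded hC i₀ (m i₀)
    set F := {β | β ∈ affRoots C ∧ SupportedIn C c β ∧ |β i₀| ≤ m i₀} with hFdef
    obtain ⟨K, hK⟩ := (hF.image fun β => -evalR x β).bddAbove
    obtain ⟨N, hN⟩ := exists_int_gt K
    refine ((hF.prod (Set.finite_Icc (0 : ℤ) N)).image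
      fun p => p.1 + p.2 • delta C m c).subset ?_
    rintro β ⟨hβ, hs, h0, hneg⟩
    have hm : (0 : ℤ) < m i₀ := by exact_mod_cast hC.marks_pos i₀
    have hd : delta C m c i₀ = m i₀ := if_pos rfl
    set k := β i₀ / (m i₀ : ℤ) with hk
    have hβ0 : β - k • delta C m c ∈ F := by
      have hs' := hs.sub ((supportedIn_delta (m := m) c).smul k)
      refine ⟨⟨?_, c, hs'⟩, hs', ?_⟩
      · simp only [form_sub_left, form_sub_right, form_smul_left, form_smul_right,
          form_delta hC, form_delta_left hC, hβ.1]
        ring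
      · have h1 := Int.emod_add_mul_ediv (β i₀) (m i₀)
        have h2 := Int.emod_nonneg (β i₀) hm.ne'
        have h3 := Int.emod_lt_of_pos (β i₀) hm
        have : (β - k • delta C m c) i₀ = β i₀ % (m i₀ : ℤ) := by
          simp only [Pi.sub_apply, Pi.smul_apply, smul_eq_mul, hd]
          linarith
        rw [this, abs_of_nonneg h2]
        exact h3.le
    refine ⟨(β - k • delta C m c, k), ⟨hβ0, Int.ediv_nonneg (h0 i₀) hm.le, ?_⟩, by simp⟩
    have h1 : -evalR x (β - k • delta C m c) ≤ K := hK ⟨_, hβ0, rfl⟩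
    rw [evalR_sub, evalR_zsmul, hx] at h1
    have : (k : ℝ) < N := by linarith
    exact_mod_cast this.le
  refine (Set.finite_iUnion key).subset ?_
  rintro β ⟨hβ, h0, hneg⟩
  obtain ⟨c, hc⟩ := hβ.2
  obtain ⟨i, hi⟩ := Function.ne_iff.1 (affRoots_ne_zero hβ)
  refine Set.mem_iUnion.2 ⟨i, hβ, ?_, h0, hneg⟩
  rwa [hc i hi]

/-- Reflecting in a simple root that is negative at x lowers the finite number of positive roots
negative at x. -/
theorem exists_actR_nonneg (hC : IsSimplyLacedAffine C m) {x : ι → ℝ}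
    (hx : ∀ c, evalR x (delta C m c) = 1) :
    ∃ g ∈ extWeyl C m, ∀ i, 0 ≤ actR g x i := by
  induction hn : {β | β ∈ affRoots C ∧ 0 ≤ β ∧ evalR x β < 0}.ncard using
    Nat.strong_induction_on generalizing x with
  | _ n ih =>
  by_cases h : ∀ i, 0 ≤ x i
  · exact ⟨1, one_mem _, by rwa [actR_one]⟩
  push Not at h
  obtain ⟨i, hi⟩ := h
  have h2 := form_simpleRoot_self hC i
  have hs : reflection C (simpleRoot i) ∈ extWeyl C m :=
    parabolic_le_extWeyl Set.univ (simpleReflection_mem_parabolic hC (Set.mem_univ i))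
  have hev : ∀ β, evalR (actR (reflection C (simpleRoot i)) x) β =
      evalR x (reflection C (simpleRoot i) β) := fun β => by
    rw [evalR_actR, reflection_inv h2]
  have hlt : {β | β ∈ affRoots C ∧ 0 ≤ β ∧
      evalR (actR (reflection C (simpleRoot i)) x) β < 0}.ncard < n := by
    rw [← hn, ← Set.ncard_image_of_injective _ (reflection C (simpleRoot i)).injective]
    refine Set.ncard_lt_ncard ((Set.ssubset_iff_of_subset ?_).2
      ⟨simpleRoot i, ⟨simpleRoot_mem_affRoots hC i, ?_, ?_⟩, ?_⟩) (finite_negative hC hx)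
    · rintro _ ⟨β, ⟨hβ, h0, hneg⟩, rfl⟩
      rw [hev] at hneg
      refine ⟨reflection_mem_affRoots hC (simpleRoot_mem_affRoots hC i) hβ,
        reflection_simpleRoot_nonneg hC hβ h0 ?_, hneg⟩
      rintro rfl
      rw [reflection_self h2, evalR_neg, evalR_simpleRoot] at hneg
      linarith
    · exact Pi.single_nonneg.2 zero_le_one
    · rwa [evalR_simpleRoot]
    · rintro ⟨β, ⟨hβ, h0, -⟩, h⟩
      have : β = -simpleRoot i := by
        rw [← reflection_reflection h2 β, h, reflection_self h2]
      have hii := h0 i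
      simp [this, simpleRoot] at hii
  obtain ⟨g, hg, hg'⟩ := ih _ hlt (fun c => by rw [evalR_actR_delta hC hs, hx]) rfl
  refine ⟨g * reflection C (simpleRoot i), mul_mem hg hs, ?_⟩
  rwa [actR_mul]

/-! ### The finite root system of a set of simple roots -/

/-- The roots supported in `I`. -/
def rootsIn (C : Matrix ι ι ℤ) (I : Set ι) : Set (ι → ℤ) :=
  {β | β ∈ affRoots C ∧ ∀ i, β i ≠ 0 → i ∈ I}

/-- No connected component of the affine diagram is contained in `I`. -/
def IsProper (C : Matrix ι ι ℤ) (I : Set ι) : Prop :=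
  ∀ c : (dynkin C).ConnectedComponent, ∃ i, (dynkin C).connectedComponentMk i = c ∧ i ∉ I

theorem simpleRoot_mem_rootsIn (hC : IsSimplyLacedAffine C m) {I : Set ι} {i : ι} (hi : i ∈ I) :
    simpleRoot i ∈ rootsIn C I := by
  refine ⟨simpleRoot_mem_affRoots hC i, fun j hj => ?_⟩
  by_cases h : j = i
  · rwa [h]
  · exact absurd (by simp [simpleRoot, h]) hj

theorem rootsIn_mono {I J : Set ι} (h : I ⊆ J) : rootsIn C I ⊆ rootsIn C J :=
  fun _ hβ => ⟨hβ.1, fun i hi => h (hβ.2 i hi)⟩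

theorem reflection_mem_rootsIn (hC : IsSimplyLacedAffine C m) {I : Set ι} {β γ : ι → ℤ}
    (hβ : β ∈ rootsIn C I) (hγ : γ ∈ rootsIn C I) : reflection C β γ ∈ rootsIn C I := by
  refine ⟨reflection_mem_affRoots hC hβ.1 hγ.1, fun i hi => ?_⟩
  rw [reflection_apply hβ.1.1] at hi
  by_cases h : β i = 0
  · exact hγ.2 i fun h' => hi (by simp [h, h'])
  · exact hβ.2 i h

theorem isFiniteLaced_rootsIn (hC : IsSimplyLacedAffine C m) {I : Set ι} (hI : IsProper C I) :
    IsFiniteLaced C (rootsIn C I) where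
  finite := by
    have := fun i => finite_affRoots_bounded hC i 0
    refine (Set.finite_iUnion this).subset ?_
    rintro β ⟨hβ, hs⟩
    obtain ⟨c, hc⟩ := hβ.2
    obtain ⟨i, rfl, hi⟩ := hI c
    refine Set.mem_iUnion.2 ⟨i, hβ, hc, ?_⟩
    have : β i = 0 := by
      by_contra h
      exact hi (hs i h)
    simp [this]
  norm β hβ := hβ.1.1
  reflect β hβ γ hγ := reflection_mem_rootsIn hC hβ hγ
  le_one β hβ γ hγ hne := by
    by_contra! h
    apply hne
    have h1 := form_self_nonneg hC (β - γ)
    have h2 : form C (β - γ) (β - γ) = 4 - 2 * form C β γ := by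
      simp only [form_sub_left, form_sub_right, hβ.1.1, hγ.1.1, form_comm hC.symm γ β]
      ring
    have h0 : form C (β - γ) (β - γ) = 0 := by omega
    rw [← sub_eq_zero]
    funext i
    obtain ⟨i₀, hi₀, hnot⟩ := hI ((dynkin C).connectedComponentMk i)
    refine eq_zero_of_form_eq_zero hC h0 hi₀.symm ?_
    have e1 : β i₀ = 0 := by
      by_contra h
      exact hnot (hβ.2 _ h)
    have e2 : γ i₀ = 0 := by
      by_contra h
      exact hnot (hγ.2 _ h)
    simp [e1, e2]

theorem evalR_const (ε : ℝ) (β : ι → ℤ) : evalR (fun _ => ε) β = (∑ i, β i : ℤ) * ε := by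
  simp [evalR, Finset.sum_mul]

theorem sum_pos_of_affRoots {β : ι → ℤ} (hβ : β ∈ affRoots C) (h0 : 0 ≤ β) : 0 < ∑ i, β i := by
  obtain ⟨i, hi⟩ := Function.ne_iff.1 (affRoots_ne_zero hβ)
  exact Finset.sum_pos' (fun i _ => h0 i)
    ⟨i, Finset.mem_univ i, lt_of_le_of_ne (h0 i) (Ne.symm hi)⟩

/-- A point in the interior of the fundamental alcove of the roots supported in `I`. -/
theorem exists_interior_point (hC : IsSimplyLacedAffine C m) {I : Set ι} (hI : IsProper C I) :
    ∃ p : ι → ℝ, ∀ β ∈ rootsIn C I, 0 ≤ β → 0 < evalR p β ∧ evalR p β < 1 := by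
  obtain ⟨N, hN⟩ := ((isFiniteLaced_rootsIn hC hI).finite.image fun β => ∑ i, β i).bddAbove
  -- A constant point evaluates a root as a multiple of its height, and N bounds the heights. The
  -- absolute value keeps the denominator positive even if the system is empty.
  refine ⟨fun _ => 1 / (|N| + 1 : ℤ), fun β hβ h0 => ?_⟩
  have h1 : ∑ i, β i ≤ N := hN ⟨β, hβ, rfl⟩
  have h2 := sum_pos_of_affRoots hβ.1 h0
  have h3 : ∑ i, β i < |N| + 1 := by
    have := le_abs_self N
    omega
  have h4 : (0 : ℝ) < (|N| + 1 : ℤ) := by exact_mod_cast h2.trans h3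
  rw [evalR_const, mul_one_div]
  constructor
  · exact div_pos (by exact_mod_cast h2) h4
  · rw [div_lt_one h4]
    exact_mod_cast h3

/-! ### Action of parabolic subgroups on coordinates and roots -/

theorem parabolic_apply_sub (hC : IsSimplyLacedAffine C m) {J : Set ι} {w : LatAut ι}
    (hw : w ∈ parabolic C J) (v : ι → ℤ) {i : ι} (hi : i ∉ J) : w v i = v i := by
  have h2 : ∀ β ∈ simpleRoot '' J, form C β β = 2 := by
    rintro _ ⟨j, -, rfl⟩
    exact form_simpleRoot_self hC j
  refine mem_of_mem_reflGroup (S := {u | u i = v i}) h2 ?_ hw rfl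
  rintro _ ⟨j, hj, rfl⟩ γ hγ
  have hne : i ≠ j := fun h => hi (h ▸ hj)
  exact (reflection_simpleRoot_apply_ne hC γ hne).trans hγ

theorem evalR_parabolic (hC : IsSimplyLacedAffine C m) {J : Set ι} {w : LatAut ι}
    (hw : w ∈ parabolic C J) {x : ι → ℝ} (hx : ∀ i ∈ J, x i = 0) (v : ι → ℤ) :
    evalR x (w v) = evalR x v := by
  refine Finset.sum_congr rfl fun i _ => ?_
  by_cases hi : i ∈ J
  · simp [hx i hi]
  · rw [parabolic_apply_sub hC hw v hi]

theorem parabolic_apply_mem_rootsIn (hC : IsSimplyLacedAffine C m) {J : Set ι} {w : LatAut ι}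
    (hw : w ∈ parabolic C J) {β : ι → ℤ} (hβ : β ∈ rootsIn C J) : w β ∈ rootsIn C J := by
  refine mem_of_mem_reflGroup (R := simpleRoot '' J) ?_ ?_ hw hβ
  · rintro _ ⟨j, -, rfl⟩
    exact form_simpleRoot_self hC j
  · rintro _ ⟨j, hj, rfl⟩ γ hγ
    exact reflection_mem_rootsIn hC (simpleRoot_mem_rootsIn hC hj) hγ

theorem preservesForm_of_mem_parabolic (hC : IsSimplyLacedAffine C m) {J : Set ι} {w : LatAut ι}
    (hw : w ∈ parabolic C J) : PreservesForm C w := by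
  refine preservesForm_of_mem_reflGroup hC.symm (R := simpleRoot '' J) ?_ hw
  rintro _ ⟨j, -, rfl⟩
  exact form_simpleRoot_self hC j

theorem subRoots_subset (hC : IsSimplyLacedAffine C m) (J : Set ι) :
    subRoots C J ⊆ rootsIn C J := by
  rintro _ ⟨w, hw, j, hj, rfl⟩
  exact parabolic_apply_mem_rootsIn hC hw (simpleRoot_mem_rootsIn hC hj)

theorem simpleRoot_mem_subRoots {J : Set ι} {j : ι} (hj : j ∈ J) :
    simpleRoot j ∈ subRoots C J :=
  ⟨1, one_mem _, j, hj, rfl⟩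

theorem apply_mem_subRoots {J : Set ι} {w : LatAut ι} (hw : w ∈ parabolic C J) {β : ι → ℤ}
    (hβ : β ∈ subRoots C J) : w β ∈ subRoots C J := by
  obtain ⟨u, hu, j, hj, rfl⟩ := hβ
  exact ⟨w * u, mul_mem hw hu, j, hj, rfl⟩

theorem neg_mem_subRoots (hC : IsSimplyLacedAffine C m) {J : Set ι} {β : ι → ℤ}
    (hβ : β ∈ subRoots C J) : -β ∈ subRoots C J := by
  obtain ⟨u, hu, j, hj, rfl⟩ := hβ
  refine ⟨u * reflection C (simpleRoot j), mul_mem hu (simpleReflection_mem_parabolic hC hj), j, hj,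
    ?_⟩
  change _ = u (reflection C (simpleRoot j) (simpleRoot j))
  rw [reflection_self (form_simpleRoot_self hC j), map_neg]

theorem reflection_mem_parabolic (hC : IsSimplyLacedAffine C m) {J : Set ι} {β : ι → ℤ}
    (hβ : β ∈ subRoots C J) : reflection C β ∈ parabolic C J := by
  obtain ⟨u, hu, j, hj, rfl⟩ := hβ
  rw [← conj_reflection (preservesForm_of_mem_parabolic hC hu) (form_simpleRoot_self hC j)]
  exact mul_mem (mul_mem hu (simpleReflection_mem_parabolic hC hj)) (inv_mem hu)

/-! ### Roots supported in I and its connected components -/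

theorem verts_subset {I : Set ι} (j : Comp C I) : j.verts ⊆ I := by
  rintro _ ⟨i, -, rfl⟩
  exact i.2

theorem mem_verts_iff {I : Set ι} {j : Comp C I} {i : ι} :
    i ∈ j.verts ↔ ∃ h : i ∈ I, ((dynkin C).induce I).connectedComponentMk ⟨i, h⟩ = j := by
  constructor
  · rintro ⟨k, hk, rfl⟩
    exact ⟨k.2, hk⟩
  · rintro ⟨h, hj⟩
    exact ⟨⟨i, h⟩, hj, rfl⟩

theorem eq_of_mem_verts {I : Set ι} {j k : Comp C I} {i l : ι} (hi : i ∈ j.verts)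
    (hl : l ∈ k.verts) (h : C i l ≠ 0) : j = k := by
  obtain ⟨hi, rfl⟩ := mem_verts_iff.1 hi
  obtain ⟨hl, rfl⟩ := mem_verts_iff.1 hl
  by_cases hil : i = l
  · subst hil; rfl
  · refine SimpleGraph.ConnectedComponent.sound (SimpleGraph.Adj.reachable ?_)
    exact (SimpleGraph.fromRel_adj (fun i j => C i j ≠ 0) _ _).2 ⟨hil, Or.inl h⟩

theorem exists_mem_subRoots_of_nonneg (hC : IsSimplyLacedAffine C m) {I : Set ι}
    (hI : IsProper C I) {β : ι → ℤ} (hβ : β ∈ rootsIn C I) (h0 : 0 ≤ β) :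
    ∃ j : Comp C I, β ∈ subRoots C j.verts := by
  induction hn : (∑ i, β i).toNat using Nat.strong_induction_on generalizing β with
  | _ n ih =>
  -- Because (β, β) = Σ (β, αᵢ) βᵢ = 2, some term is positive; subtracting that αᵢ lowers the
  -- height.
  have : ∃ i, 0 < form C β (simpleRoot i) * β i := by
    by_contra! h
    have h2 := hβ.1.1
    rw [form_eq_sum] at h2
    have := Finset.sum_nonpos fun i (_ : i ∈ Finset.univ) => h i
    omega
  obtain ⟨i, hi⟩ := this
  have hβi : β i ≠ 0 := right_ne_zero_of_mul hi.ne'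
  have hform : 0 < form C β (simpleRoot i) := pos_of_mul_pos_left hi (h0 i)
  have hiI : i ∈ I := hβ.2 i hβi
  by_cases hs : β = simpleRoot i
  · rw [hs]
    exact ⟨((dynkin C).induce I).connectedComponentMk ⟨i, hiI⟩,
      simpleRoot_mem_subRoots (mem_verts_iff.2 ⟨hiI, rfl⟩)⟩
  have hsi := simpleRoot_mem_rootsIn hC hiI
  have h1 : form C β (simpleRoot i) = 1 :=
    le_antisymm ((isFiniteLaced_rootsIn hC hI).le_one _ hβ _ hsi hs) hform
  have h2 := form_simpleRoot_self hC i
  have hrefl : reflection C (simpleRoot i) β = β - simpleRoot i := by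
    rw [reflection_apply h2, h1, one_smul]
  have hγ := reflection_mem_rootsIn hC hsi hβ
  have hγ0 := reflection_simpleRoot_nonneg hC hβ.1 h0 hs
  have hlt : (∑ k, reflection C (simpleRoot i) β k).toNat < n := by
    have hpos := sum_pos_of_affRoots hβ.1 h0
    have : ∑ k, reflection C (simpleRoot i) β k = ∑ k, β k - 1 := by
      rw [hrefl]
      simp [simpleRoot, Pi.single_apply]
    omega
  obtain ⟨j, hj⟩ := ih _ hlt hγ hγ0 rfl
  -- The smaller root β - αᵢ pairs to -1 with αᵢ, so its support contains a vertex k with C k i ≠ 0,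
  -- which forces i into the same component.
  have hij : i ∈ j.verts := by
    have hne : form C (reflection C (simpleRoot i) β) (simpleRoot i) ≠ 0 := by
      rw [hrefl, form_sub_left, h1, h2]
      norm_num
    have : ∃ k, reflection C (simpleRoot i) β k ≠ 0 ∧ C k i ≠ 0 := by
      by_contra! h
      apply hne
      rw [form_simpleRoot_right]
      refine Finset.sum_eq_zero fun k _ => ?_
      by_cases hk : reflection C (simpleRoot i) β k = 0
      · rw [hk, zero_mul]
      · rw [h k hk, mul_zero]
    obtain ⟨k, hk, hki⟩ := this
    have hkj : k ∈ j.verts := (subRoots_subset hC _ hj).2 k hk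
    have : i ∈ Comp.verts (((dynkin C).induce I).connectedComponentMk ⟨i, hiI⟩) :=
      mem_verts_iff.2 ⟨hiI, rfl⟩
    rwa [eq_of_mem_verts hkj this hki]
  refine ⟨j, ?_⟩
  rw [← reflection_reflection h2 β]
  exact apply_mem_subRoots (simpleReflection_mem_parabolic hC hij) hj

theorem mem_rootsIn_iff (hC : IsSimplyLacedAffine C m) {I : Set ι} (hI : IsProper C I)
    {β : ι → ℤ} : β ∈ rootsIn C I ↔ ∃ j : Comp C I, β ∈ subRoots C j.verts := by
  constructor
  · intro hβ
    rcases nonneg_or_nonpos hC hβ.1 with h | h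
    · exact exists_mem_subRoots_of_nonneg hC hI hβ h
    · obtain ⟨j, hj⟩ := exists_mem_subRoots_of_nonneg hC hI
        ((isFiniteLaced_rootsIn hC hI).neg_mem hβ) (neg_nonneg.2 h)
      exact ⟨j, by simpa using neg_mem_subRoots hC hj⟩
  · rintro ⟨j, hj⟩
    exact rootsIn_mono (verts_subset j) (subRoots_subset hC _ hj)

/-! ### Moving a point to the alcove of a finite root system, modulo integers -/

theorem form_simpleRoot_left (i : ι) (u : ι → ℤ) :
    form C (simpleRoot i) u = ∑ j, C i j * u j := by
  simp [form, simpleRoot, Pi.single_apply]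

theorem evalR_pairing (z : ι → ℝ) (s : ℝ) (β v : ι → ℤ) :
    evalR (fun i => z i - s * form C (simpleRoot i) β) v = evalR z v - s * form C v β := by
  have h : (form C v β : ℝ) = ∑ i, (v i : ℝ) * form C (simpleRoot i) β := by
    simp_rw [form_simpleRoot_left]
    unfold form
    push_cast
    refine Finset.sum_congr rfl fun i _ => ?_
    rw [Finset.mul_sum]
    exact Finset.sum_congr rfl fun j _ => by ring
  rw [h, evalR, evalR, Finset.mul_sum, ← Finset.sum_sub_distrib]
  exact Finset.sum_congr rfl fun i _ => by ring

/-- Reindexing the sum by s_β and averaging the two expressions isolates ξ(β). This makes the sum of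
squares over R behave like a Weyl-invariant metric. -/
theorem IsFiniteLaced.two_mul_sum {R : Set (ι → ℤ)} (hR : IsFiniteLaced C R) (ξ : ι → ℝ)
    {β : ι → ℤ} (hβ : β ∈ R) :
    2 * ∑ γ ∈ hR.finite.toFinset, evalR ξ γ * form C γ β =
      evalR ξ β * ∑ γ ∈ hR.finite.toFinset, (form C γ β : ℝ) ^ 2 := by
  have h2 := hR.norm β hβ
  have h : ∑ γ ∈ hR.finite.toFinset, evalR ξ γ * form C γ β =
      ∑ γ ∈ hR.finite.toFinset, (evalR ξ γ - form C γ β * evalR ξ β) * -(form C γ β : ℝ) := by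
    refine Finset.sum_nbij' (reflection C β) (reflection C β) ?_ ?_ ?_ ?_ ?_
    · simpa using fun γ hγ => hR.reflect β hβ γ hγ
    · simpa using fun γ hγ => hR.reflect β hβ γ hγ
    · exact fun γ _ => reflection_reflection h2 γ
    · exact fun γ _ => reflection_reflection h2 γ
    · intro γ _
      rw [reflection_apply h2, evalR_sub, evalR_zsmul, form_sub_left, form_smul_left, h2]
      push_cast
      ring
  rw [two_mul]
  nth_rw 1 [h]
  rw [← Finset.sum_add_distrib, Finset.mul_sum]
  exact Finset.sum_congr rfl fun γ _ => by ring

theorem finite_int_translates (s B : ℝ) : {t : ℝ | |t| ≤ B ∧ ∃ k : ℤ, t = s + k}.Finite := by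
  refine ((Set.finite_Icc ⌊-B - s⌋ ⌈B - s⌉).image fun k : ℤ => s + k).subset ?_
  rintro _ ⟨ht, k, rfl⟩
  obtain ⟨h1, h2⟩ := abs_le.1 ht
  refine ⟨k, ⟨?_, ?_⟩, rfl⟩
  · have : ((⌊-B - s⌋ : ℤ) : ℝ) ≤ k := (Int.floor_le _).trans (by linarith)
    exact_mod_cast this
  · have : (k : ℝ) ≤ ((⌈B - s⌉ : ℤ) : ℝ) := le_trans (by linarith) (Int.le_ceil _)
    exact_mod_cast this

/-- A point of the orbit closest to p, in the metric Q, lies on the same closed side as p of every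
hyperplane β = k; otherwise the affine reflection in it would bring the point closer. The orbit
allows every integral shift, since root variables see y only modulo integers. -/
theorem exists_alcove_representative (hC : IsSimplyLacedAffine C m) {I : Set ι}
    (hI : IsProper C I) {p : ι → ℝ}
    (hp : ∀ β ∈ rootsIn C I, 0 ≤ β → 0 < evalR p β ∧ evalR p β < 1) (y : ι → ℝ) :
    ∃ u ∈ parabolic C I, ∃ z : ι → ℝ, (∀ v, ∃ k : ℤ, evalR z v = evalR y (u⁻¹ v) + k) ∧
      ∀ β ∈ rootsIn C I, 0 ≤ β → 0 ≤ evalR z β ∧ evalR z β ≤ 1 := by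
  have hR := isFiniteLaced_rootsIn hC hI
  set R := rootsIn C I with hRdef
  set O : Set (ι → ℝ) :=
    {z | ∃ u ∈ parabolic C I, ∀ v, ∃ k : ℤ, evalR z v = evalR y (u⁻¹ v) + k} with hO
  have hyO : y ∈ O := ⟨1, one_mem _, fun v => ⟨0, by simp⟩⟩
  let Q : (ι → ℝ) → ℝ := fun z => ∑ γ ∈ hR.finite.toFinset, (evalR z γ - evalR p γ) ^ 2
  have hmin : ∃ z ∈ O, ∀ z' ∈ O, Q z ≤ Q z' := by
    -- On the orbit each value at a root lies in one of finitely many classes modulo ℤ, so below any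
    -- bound Q takes finitely many values and a minimum exists. The bound `Q y + 1` follows from t²
    -- ≤ Q y.
    have hfin : (Q '' {z | z ∈ O ∧ Q z ≤ Q y}).Finite := by
      let D : (ι → ℤ) → Set ℝ := fun γ => ⋃ γ' ∈ R,
        {t : ℝ | |t| ≤ Q y + 1 ∧ ∃ k : ℤ, t = (evalR y γ' - evalR p γ) + k}
      have hD : ∀ γ, (D γ).Finite := fun γ =>
        hR.finite.biUnion fun γ' _ => finite_int_translates _ _
      have hpi : (Set.pi Set.univ fun γ : hR.finite.toFinset => D γ).Finite :=
        Set.Finite.pi fun γ => hD γ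
      refine (hpi.image fun f => ∑ γ, f γ ^ 2).subset ?_
      rintro _ ⟨z, ⟨⟨u, hu, hz⟩, hle⟩, rfl⟩
      refine ⟨fun γ => evalR z γ - evalR p γ, fun γ _ => ?_, ?_⟩
      · have hγ : (γ : ι → ℤ) ∈ R := hR.finite.mem_toFinset.1 γ.2
        refine Set.mem_biUnion (parabolic_apply_mem_rootsIn hC (inv_mem hu) hγ) ⟨?_, ?_⟩
        · have h1 : (evalR z γ - evalR p γ) ^ 2 ≤ Q z :=
            Finset.single_le_sum (f := fun γ => (evalR z γ - evalR p γ) ^ 2)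
              (fun γ _ => sq_nonneg _) γ.2
          have h2 := sq_abs (evalR z γ - evalR p γ)
          nlinarith [sq_nonneg (|evalR z γ - evalR p γ| - 1), sq_nonneg (|evalR z γ - evalR p γ|)]
        · obtain ⟨k, hk⟩ := hz γ
          exact ⟨k, by simp only [hk]; ring⟩
      · exact Finset.sum_coe_sort hR.finite.toFinset fun γ => (evalR z γ - evalR p γ) ^ 2
    obtain ⟨_, ⟨z, ⟨hz, hzy⟩, rfl⟩, hle⟩ := Set.exists_min_image _ id hfin
      ⟨_, y, ⟨hyO, le_rfl⟩, rfl⟩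
    refine ⟨z, hz, fun z' hz' => ?_⟩
    rcases le_total (Q z') (Q y) with h | h
    · exact hle _ ⟨z', ⟨hz', h⟩, rfl⟩
    · exact hzy.trans h
  obtain ⟨z, hz, hmin⟩ := hmin
  have key : ∀ β ∈ R, ∀ k : ℤ, 0 ≤ (evalR z β - k) * (evalR p β - k) := by
    intro β hβ k
    have h2 := hR.norm β hβ
    set s := evalR z β - k with hs
    -- With s = z(β) - k this is the reflection of z in the hyperplane β = k.
    have hz' : (fun i => z i - s * form C (simpleRoot i) β) ∈ O := by
      obtain ⟨u, hu, hz⟩ := hz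
      have hβp : reflection C β ∈ parabolic C I := by
        obtain ⟨j, hj⟩ := (mem_rootsIn_iff hC hI).1 hβ
        exact parabolic_mono (verts_subset j) (reflection_mem_parabolic hC hj)
      refine ⟨reflection C β * u, mul_mem hβp hu, fun v => ?_⟩
      obtain ⟨l, hl⟩ := hz (reflection C β v)
      refine ⟨l + k * form C v β, ?_⟩
      rw [mul_inv_rev, reflection_inv h2]
      change _ = evalR y (u⁻¹ (reflection C β v)) + _
      rw [← sub_eq_iff_eq_add] at hl
      rw [← hl, evalR_pairing, hs, reflection_apply h2, evalR_sub, evalR_zsmul]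
      push_cast
      ring
    have h3 := hmin _ hz'
    have h4 : Q (fun i => z i - s * form C (simpleRoot i) β) = Q z +
        (∑ γ ∈ hR.finite.toFinset, (form C γ β : ℝ) ^ 2) * (s * (evalR p β - k)) := by
      have h5 := hR.two_mul_sum (z - p) hβ
      have h6 : Q (fun i => z i - s * form C (simpleRoot i) β) = Q z -
          s * (2 * ∑ γ ∈ hR.finite.toFinset, evalR (z - p) γ * form C γ β) +
          s ^ 2 * ∑ γ ∈ hR.finite.toFinset, (form C γ β : ℝ) ^ 2 := by
        simp only [Q, Finset.mul_sum]
        rw [← Finset.sum_sub_distrib, ← Finset.sum_add_distrib]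
        refine Finset.sum_congr rfl fun γ _ => ?_
        rw [evalR_pairing, evalR_sub_left]
        ring
      rw [h6, h5, evalR_sub_left, hs]
      ring
    have h7 : 0 < ∑ γ ∈ hR.finite.toFinset, (form C γ β : ℝ) ^ 2 := by
      refine Finset.sum_pos' (fun _ _ => sq_nonneg _) ⟨β, by simpa using hβ, ?_⟩
      rw [h2]
      norm_num
    rw [h4] at h3
    exact (mul_nonneg_iff_of_pos_left h7).1 (by linarith)
  obtain ⟨u, hu, hz⟩ := hz
  refine ⟨u, hu, z, hz, fun β hβ h0 => ?_⟩
  obtain ⟨hp0, hp1⟩ := hp β hβ h0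
  have k0 := key β hβ 0
  have k1 := key β hβ 1
  push_cast at k0 k1
  constructor <;> nlinarith

/-! ### Products of parabolic subgroups -/

theorem commute_reflection (hC : C.IsSymm) {β γ : ι → ℤ} (hβ : form C β β = 2)
    (hγ : form C γ γ = 2) (h : form C β γ = 0) :
    Commute (reflection C β) (reflection C γ) := by
  refine LinearEquiv.ext fun v => ?_
  change reflection C β (reflection C γ v) = reflection C γ (reflection C β v)
  simp only [reflection_apply hβ, reflection_apply hγ, form_sub_left, form_smul_left, h,
    form_comm hC γ β]
  module

theorem commute_of_mem_reflGroup (hC : C.IsSymm) {R S : Set (ι → ℤ)}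
    (hR : ∀ β ∈ R, form C β β = 2) (hS : ∀ β ∈ S, form C β β = 2)
    (h : ∀ β ∈ R, ∀ γ ∈ S, form C β γ = 0) {x y : LatAut ι} (hx : x ∈ reflGroup C R)
    (hy : y ∈ reflGroup C S) : Commute x y := by
  have h1 : reflGroup C R ≤ Subgroup.centralizer (reflGroup C S) := by
    refine reflGroup_le hR fun β hβ => ?_
    rw [Subgroup.mem_centralizer_iff]
    have h2 : reflGroup C S ≤ Subgroup.centralizer {reflection C β} := by
      refine reflGroup_le hS fun γ hγ => ?_
      rw [Subgroup.mem_centralizer_singleton_iff]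
      exact (commute_reflection hC (hR β hβ) (hS γ hγ) (h β hβ γ hγ)).eq.symm
    exact fun s hs => Subgroup.mem_centralizer_singleton_iff.1 (h2 hs)
  exact (Subgroup.mem_centralizer_iff.1 (h1 hx) y hy).symm

theorem cartan_eq_zero {I : Set ι} {j k : Comp C I} (hjk : j ≠ k) {i l : ι} (hi : i ∈ j.verts)
    (hl : l ∈ k.verts) : C i l = 0 := by
  by_contra h
  exact hjk (eq_of_mem_verts hi hl h)

theorem commute_parabolic (hC : IsSimplyLacedAffine C m) {I : Set ι} {j k : Comp C I}
    (hjk : j ≠ k) {x y : LatAut ι} (hx : x ∈ parabolic C j.verts)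
    (hy : y ∈ parabolic C k.verts) : Commute x y := by
  refine commute_of_mem_reflGroup hC.symm ?_ ?_ ?_ hx hy
  · rintro _ ⟨i, -, rfl⟩
    exact form_simpleRoot_self hC i
  · rintro _ ⟨i, -, rfl⟩
    exact form_simpleRoot_self hC i
  · rintro _ ⟨i, hi, rfl⟩ _ ⟨l, hl, rfl⟩
    rw [form_simpleRoot, cartan_eq_zero hjk hi hl]

/-- Independence holds because an element of one factor changes only the coordinates in its
component, while a product of elements of the others changes only coordinates outside it. -/
theorem isInternalProd_of_le_parabolic (hC : IsSimplyLacedAffine C m) {I : Set ι}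
    {H : Comp C I → Subgroup (LatAut ι)} (hH : ∀ j, H j ≤ parabolic C j.verts) :
    IsInternalProd H (⨆ j, H j) where
  commute j k hjk x hx y hy := commute_parabolic hC hjk (hH j hx) (hH k hy)
  indep j := by
    rw [Subgroup.disjoint_def]
    intro x hx hx'
    have hle : ⨆ k, ⨆ (_ : k ≠ j), H k ≤ parabolic C (j.verts)ᶜ := by
      refine iSup₂_le fun k hk => (hH k).trans (parabolic_mono fun i hi hij => hk ?_)
      exact eq_of_mem_verts hi hij (by rw [hC.diag]; norm_num)
    refine LinearEquiv.ext fun v => funext fun i => ?_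
    by_cases hi : i ∈ j.verts
    · exact parabolic_apply_sub hC (hle hx') v (fun h => h hi)
    · exact parabolic_apply_sub hC (hH j hx) v hi
  iSup_eq := rfl

theorem parabolic_le_iSup (hC : IsSimplyLacedAffine C m) (I : Set ι) :
    parabolic C I ≤ ⨆ j : Comp C I, parabolic C j.verts := by
  refine reflGroup_le (R := simpleRoot '' I) ?_ ?_
  · rintro _ ⟨i, -, rfl⟩
    exact form_simpleRoot_self hC i
  · rintro _ ⟨i, hi, rfl⟩
    exact Subgroup.mem_iSup_of_mem (((dynkin C).induce I).connectedComponentMk ⟨i, hi⟩)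
      (simpleReflection_mem_parabolic hC (mem_verts_iff.2 ⟨hi, rfl⟩))

theorem parabolic_apply_of_support (hC : IsSimplyLacedAffine C m) {I : Set ι} {j k : Comp C I}
    (hjk : j ≠ k) {w : LatAut ι} (hw : w ∈ parabolic C k.verts) {v : ι → ℤ}
    (hv : ∀ i, v i ≠ 0 → i ∈ j.verts) : w v = v := by
  refine mem_of_mem_reflGroup (R := simpleRoot '' k.verts) (S := {v}) ?_ ?_ hw rfl
  · rintro _ ⟨i, -, rfl⟩
    exact form_simpleRoot_self hC i
  · rintro _ ⟨i, hi, rfl⟩ γ rfl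
    rw [reflection_apply (form_simpleRoot_self hC i), form_eq_zero_of_support]
    · simp
    · intro l i' hl hi'
      have : i' = i := by
        by_contra h
        exact hi' (by simp [simpleRoot, h])
      subst this
      exact cartan_eq_zero hjk (hv l hl) hi

/-- The f j are the components of u. The last clause stands for "u is their product" in the form in
which membership in a join of subgroups is checked. -/
theorem exists_parabolic_decomposition (hC : IsSimplyLacedAffine C m) {I : Set ι} {u : LatAut ι}
    (hu : u ∈ parabolic C I) :
    ∃ f : Comp C I → LatAut ι, (∀ j, f j ∈ parabolic C j.verts) ∧
      (∀ j v, (∀ i, v i ≠ 0 → i ∈ j.verts) → u⁻¹ v = (f j)⁻¹ v) ∧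
      ∀ K : Subgroup (LatAut ι), (∀ j, f j ∈ K) → u ∈ K := by
  classical
  have : Finite (Comp C I) := Quot.finite _
  have := Fintype.ofFinite (Comp C I)
  have hcomm : Pairwise fun j k : Comp C I => ∀ x y : LatAut ι,
      x ∈ parabolic C j.verts → y ∈ parabolic C k.verts → Commute x y :=
    fun j k hjk x y hx hy => commute_parabolic hC hjk hx hy
  have hmem := parabolic_le_iSup hC I hu
  rw [← Subgroup.noncommPiCoprod_range (hcomm := hcomm)] at hmem
  obtain ⟨f, rfl⟩ := hmem
  have hK : ∀ (f : ∀ j : Comp C I, parabolic C j.verts) (K : Subgroup (LatAut ι)),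
      (∀ j, (f j : LatAut ι) ∈ K) → Subgroup.noncommPiCoprod hcomm f ∈ K := by
    intro f K h
    exact Subgroup.noncommProd_mem (t := Finset.univ) (f := fun j => (f j : LatAut ι)) K
      (fun j _ k _ hjk => commute_parabolic hC hjk (f j).2 (f k).2) fun j _ => h j
  refine ⟨fun j => f j, fun j => (f j).2, fun j v hv => ?_, hK f⟩
  have hsplit : f = Function.update f j 1 * Pi.mulSingle j (f j) := by
    funext k
    by_cases hk : k = j
    · subst hk; simp
    · simp [hk]
  have hfix : Subgroup.noncommPiCoprod hcomm (Function.update f j 1) ∈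
      MulAction.stabilizer (LatAut ι) v := by
    refine hK _ _ fun k => ?_
    by_cases hk : k = j
    · subst hk; simp
    · rw [Function.update_of_ne hk]
      exact parabolic_apply_of_support hC (Ne.symm hk) (f k).2 hv
  have hinv : (Subgroup.noncommPiCoprod hcomm (Function.update f j 1))⁻¹ v = v := inv_mem hfix
  conv_lhs => rw [hsplit, map_mul, Subgroup.noncommPiCoprod_mulSingle, mul_inv_rev]
  change (f j : LatAut ι)⁻¹ ((Subgroup.noncommPiCoprod hcomm (Function.update f j 1))⁻¹ v) = _
  rw [hinv]

/-! ### Elements mapping an alcove to a translate -/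

theorem mem_actR_image {w : LatAut ι} {S : Set (ι → ℝ)} {z : ι → ℝ} :
    z ∈ actR w '' S ↔ actR w⁻¹ z ∈ S := by
  constructor
  · rintro ⟨x, hx, rfl⟩
    rwa [← actR_mul, inv_mul_cancel, actR_one]
  · exact fun h => ⟨_, h, by rw [← actR_mul, mul_inv_cancel, actR_one]⟩

theorem mem_subAlcove_iff (hC : IsSimplyLacedAffine C m) {J : Set ι} {z : ι → ℝ} :
    z ∈ subAlcove C J ↔ ∀ β ∈ subRoots C J, 0 ≤ β → 0 ≤ evalR z β ∧ evalR z β ≤ 1 := by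
  constructor
  · rintro ⟨h1, h2⟩ β hβ h0
    refine ⟨Finset.sum_nonneg fun i _ => ?_, h2 β hβ⟩
    by_cases hi : β i = 0
    · simp [hi]
    · exact mul_nonneg (by exact_mod_cast h0 i) (h1 i ((subRoots_subset hC J hβ).2 i hi))
  · refine fun h => ⟨fun j hj => ?_, fun β hβ => ?_⟩
    · rw [← evalR_simpleRoot z j]
      exact (h _ (simpleRoot_mem_subRoots hj) (Pi.single_nonneg.2 zero_le_one)).1
    · rcases nonneg_or_nonpos hC (subRoots_subset hC J hβ).1 with h0 | h0
      · exact (h β hβ h0).2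
      · have := (h _ (neg_mem_subRoots hC hβ) (neg_nonneg.2 h0)).1
        rw [evalR_neg] at this
        linarith

/-- On the image of the alcove under u, a positive β ranges in [0, 1] or in [-1, 0] according to the
sign of u⁻¹β. The values 0 and -1 of v are the lower ends of these intervals. -/
theorem mem_omegaFin_of_shift (hC : IsSimplyLacedAffine C m) {J : Set ι} {u : LatAut ι}
    (hu : u ∈ parabolic C J) (v : ι → ℝ)
    (hv : ∀ β ∈ subRoots C J, 0 ≤ β →
      (0 ≤ u⁻¹ β → evalR v β = 0) ∧ (u⁻¹ β ≤ 0 → evalR v β = -1)) :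
    u ∈ omegaFin C J := by
  refine ⟨hu, v, Set.ext fun z => ?_⟩
  have huinv : ∀ γ, u⁻¹ (u γ) = γ := fun γ => LinearEquiv.symm_apply_apply u γ
  rw [mem_actR_image, Set.mem_vadd_set_iff_neg_vadd_mem, vadd_eq_add, neg_add_eq_sub,
    mem_subAlcove_iff hC, mem_subAlcove_iff hC]
  constructor
  · intro h β hβ h0
    have hmem := apply_mem_subRoots (inv_mem hu) hβ
    have hz : ∀ γ, evalR (actR u⁻¹ z) γ = evalR z (u γ) := fun γ => by rw [evalR_actR, inv_inv]
    have huu : u (u⁻¹ β) = β := LinearEquiv.apply_symm_apply u β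
    rw [evalR_sub_left]
    rcases nonneg_or_nonpos hC (subRoots_subset hC J hmem).1 with h1 | h1
    · have := h _ hmem h1
      rw [hz, huu] at this
      rw [(hv β hβ h0).1 h1, sub_zero]
      exact this
    · have := h _ (neg_mem_subRoots hC hmem) (neg_nonneg.2 h1)
      rw [hz, map_neg, huu, evalR_neg] at this
      rw [(hv β hβ h0).2 h1]
      constructor <;> linarith
  · intro h γ hγ h0
    have hmem := apply_mem_subRoots hu hγ
    rw [evalR_actR, inv_inv]
    rcases nonneg_or_nonpos hC (subRoots_subset hC J hmem).1 with h1 | h1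
    · have h2 := h _ hmem h1
      rwa [evalR_sub_left, (hv _ hmem h1).1 (by rwa [huinv]), sub_zero] at h2
    · have hneg := neg_mem_subRoots hC hmem
      have h2 := h _ hneg (neg_nonneg.2 h1)
      rw [evalR_sub_left, (hv _ hneg (neg_nonneg.2 h1)).2
        (by rw [map_neg, huinv]; exact neg_nonpos.2 h0), evalR_neg] at h2
      constructor <;> linarith

/-! ### Conjugation by automorphisms carrying simple roots to simple roots -/

theorem conj_mem_parabolic (hC : IsSimplyLacedAffine C m) {J K : Set ι} {h : LatAut ι}
    (hf : PreservesForm C h) (hJK : ∀ i ∈ J, ∃ l ∈ K, h (simpleRoot i) = simpleRoot l)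
    {n : LatAut ι} (hn : n ∈ parabolic C J) : h * n * h⁻¹ ∈ parabolic C K := by
  refine conj_mem_reflGroup (R := simpleRoot '' J) (S := simpleRoot '' K) ?_ hf ?_ hn
  · rintro _ ⟨j, -, rfl⟩
    exact form_simpleRoot_self hC j
  · rintro _ ⟨j, hj, rfl⟩
    obtain ⟨l, hl, h⟩ := hJK j hj
    exact ⟨l, hl, h.symm⟩

theorem apply_mem_subRoots_of_conj (hC : IsSimplyLacedAffine C m) {J K : Set ι} {h : LatAut ι}
    (hf : PreservesForm C h) (hJK : ∀ i ∈ J, ∃ l ∈ K, h (simpleRoot i) = simpleRoot l)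
    {β : ι → ℤ} (hβ : β ∈ subRoots C J) : h β ∈ subRoots C K := by
  obtain ⟨w, hw, j, hj, rfl⟩ := hβ
  obtain ⟨l, hl, hjl⟩ := hJK j hj
  refine ⟨h * w * h⁻¹, conj_mem_parabolic hC hf hJK hw, l, hl, ?_⟩
  rw [← hjl]
  exact congrArg (fun v => h (w v)) (LinearEquiv.symm_apply_apply h (simpleRoot j)).symm

theorem actR_mem_subAlcove (hC : IsSimplyLacedAffine C m) {J K : Set ι} {h : LatAut ι}
    (hf : PreservesForm C h) (hKJ : ∀ l ∈ K, ∃ i ∈ J, h⁻¹ (simpleRoot l) = simpleRoot i)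
    {z : ι → ℝ} (hz : z ∈ subAlcove C J) : actR h z ∈ subAlcove C K := by
  refine ⟨fun l hl => ?_, fun β hβ => ?_⟩
  · obtain ⟨i, hi, h1⟩ := hKJ l hl
    rw [actR, h1, evalR_simpleRoot]
    exact hz.1 i hi
  · rw [evalR_actR]
    exact hz.2 _ (apply_mem_subRoots_of_conj hC hf.inv hKJ hβ)

theorem conj_mem_omegaFin (hC : IsSimplyLacedAffine C m) {J K : Set ι} {h : LatAut ι}
    (hf : PreservesForm C h) (hJK : ∀ i ∈ J, ∃ l ∈ K, h (simpleRoot i) = simpleRoot l)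
    (hKJ : ∀ l ∈ K, ∃ i ∈ J, h⁻¹ (simpleRoot l) = simpleRoot i)
    {n : LatAut ι} (hn : n ∈ omegaFin C J) : h * n * h⁻¹ ∈ omegaFin C K := by
  obtain ⟨hn, v, hv⟩ := hn
  have himg : actR h '' subAlcove C J = subAlcove C K := by
    refine Set.Subset.antisymm ?_ fun z hz => mem_actR_image.2 ?_
    · rintro _ ⟨z, hz, rfl⟩
      exact actR_mem_subAlcove hC hf hKJ hz
    · exact actR_mem_subAlcove hC hf.inv (by rwa [inv_inv]) hz
  refine ⟨conj_mem_parabolic hC hf hJK hn, actR h v, ?_⟩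
  conv_lhs => rw [← himg]
  rw [actR_image_image, inv_mul_cancel_right, ← actR_image_image, hv, actR_image_vadd, himg]

/-! ### Diagram automorphisms preserving a set of simple roots -/

theorem simpleRoot_injective : Function.Injective (simpleRoot : ι → ι → ℤ) := by
  intro i j h
  by_contra hij
  have := congrFun h i
  simp [simpleRoot, hij] at this

theorem exists_apply_simpleRoot {I : Set ι} {h : LatAut ι}
    (hs : h ∈ MulAction.stabilizer (LatAut ι) (simpleRoot '' I : Set (ι → ℤ))) {i : ι}
    (hi : i ∈ I) : ∃ l ∈ I, h (simpleRoot i) = simpleRoot l := by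
  have : h • simpleRoot i ∈ (simpleRoot '' I : Set (ι → ℤ)) := by
    rw [← MulAction.mem_stabilizer_iff.1 hs]
    exact Set.smul_mem_smul_set ⟨i, hi, rfl⟩
  obtain ⟨l, hl, h⟩ := this
  exact ⟨l, hl, h.symm⟩

/-- Preserving the form, h induces an injection σ of I respecting Cartan entries, hence a
homomorphism of the induced graph, which maps components into components. -/
theorem exists_comp_image {I : Set ι} {h : LatAut ι} (hf : PreservesForm C h)
    (hs : h ∈ MulAction.stabilizer (LatAut ι) (simpleRoot '' I : Set (ι → ℤ))) (j : Comp C I) :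
    ∃ k : Comp C I, ∀ i ∈ j.verts, ∃ l ∈ k.verts, h (simpleRoot i) = simpleRoot l := by
  choose! σ hσI hσ using fun i (hi : i ∈ I) => exists_apply_simpleRoot hs hi
  have hcart : ∀ i ∈ I, ∀ l ∈ I, C (σ i) (σ l) = C i l := by
    intro i hi l hl
    rw [← form_simpleRoot (C := C) (σ i) (σ l), ← hσ i hi, ← hσ l hl, hf, form_simpleRoot]
  let F : (dynkin C).induce I →g (dynkin C).induce I :=
    { toFun := fun i => ⟨σ i, hσI i i.2⟩
      map_rel' := by
        rintro ⟨i, hi⟩ ⟨l, hl⟩ hil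
        have hil : (dynkin C).Adj i l := hil
        change (dynkin C).Adj (σ i) (σ l)
        rw [dynkin, SimpleGraph.fromRel_adj] at hil ⊢
        rw [hcart i hi l hl, hcart l hl i hi]
        refine ⟨fun h1 => hil.1 ?_, hil.2⟩
        have := (hσ i hi).trans ((congrArg simpleRoot h1).trans (hσ l hl).symm)
        exact simpleRoot_injective (h.injective this) }
  refine ⟨j.map F, fun i hi => ?_⟩
  obtain ⟨hiI, rfl⟩ := mem_verts_iff.1 hi
  exact ⟨σ i, mem_verts_iff.2 ⟨hσI i hiI, rfl⟩, hσ i hiI⟩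

theorem exists_comp_image_iff (hC : IsSimplyLacedAffine C m) {I : Set ι} {h : LatAut ι}
    (hf : PreservesForm C h)
    (hs : h ∈ MulAction.stabilizer (LatAut ι) (simpleRoot '' I : Set (ι → ℤ))) (j : Comp C I) :
    ∃ k : Comp C I, (∀ i ∈ j.verts, ∃ l ∈ k.verts, h (simpleRoot i) = simpleRoot l) ∧
      ∀ l ∈ k.verts, ∃ i ∈ j.verts, h⁻¹ (simpleRoot l) = simpleRoot i := by
  obtain ⟨k, hk⟩ := exists_comp_image hf hs j
  obtain ⟨j', hj'⟩ := exists_comp_image hf.inv (inv_mem hs) k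
  have : j' = j := by
    induction j using SimpleGraph.ConnectedComponent.ind with
    | _ i =>
    obtain ⟨i, hi⟩ := i
    have hij : i ∈ Comp.verts (((dynkin C).induce I).connectedComponentMk ⟨i, hi⟩) :=
      mem_verts_iff.2 ⟨hi, rfl⟩
    obtain ⟨l, hl, h1⟩ := hk i hij
    obtain ⟨i', hi', h2⟩ := hj' l hl
    have h3 : h⁻¹ (h (simpleRoot i)) = simpleRoot i := LinearEquiv.symm_apply_apply h _
    rw [← h1, h3] at h2
    rw [← simpleRoot_injective h2] at hi'
    exact eq_of_mem_verts hi' hij (by rw [hC.diag]; norm_num)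
  subst this
  exact ⟨k, hk, hj'⟩

theorem apply_nonneg_of_stabilizes {I : Set ι} {h : LatAut ι}
    (hs : h ∈ MulAction.stabilizer (LatAut ι) (simpleRoot '' I : Set (ι → ℤ))) {β : ι → ℤ}
    (hβ : ∀ i, β i ≠ 0 → i ∈ I) (h0 : 0 ≤ β) : 0 ≤ h β := by
  rw [apply_eq_sum]
  refine Finset.sum_nonneg fun i _ => ?_
  by_cases hi : β i = 0
  · simp [hi]
  · obtain ⟨l, -, hl⟩ := exists_apply_simpleRoot hs (hβ i hi)
    rw [hl]
    exact smul_nonneg (h0 i) (Pi.single_nonneg.2 zero_le_one)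

theorem parabolic_le_reflGroup (hC : IsSimplyLacedAffine C m) (I : Set ι) :
    parabolic C I ≤ reflGroup C (rootsIn C I) := by
  refine reflGroup_le (R := simpleRoot '' I) ?_ ?_
  · rintro _ ⟨i, -, rfl⟩
    exact form_simpleRoot_self hC i
  · rintro _ ⟨i, hi, rfl⟩
    exact reflection_mem_reflGroup (simpleRoot_mem_rootsIn hC hi) (form_simpleRoot_self hC i)

theorem reflGroup_le_parabolic (hC : IsSimplyLacedAffine C m) {I : Set ι} (hI : IsProper C I) :
    reflGroup C (rootsIn C I) ≤ parabolic C I := by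
  refine reflGroup_le (fun β hβ => hβ.1.1) fun β hβ => ?_
  obtain ⟨j, hj⟩ := (mem_rootsIn_iff hC hI).1 hβ
  exact parabolic_mono (verts_subset j) (reflection_mem_parabolic hC hj)

theorem evalR_pos_iff (hC : IsSimplyLacedAffine C m) {I : Set ι} {p : ι → ℝ}
    (hp : ∀ β ∈ rootsIn C I, 0 ≤ β → 0 < evalR p β ∧ evalR p β < 1) {β : ι → ℤ}
    (hβ : β ∈ rootsIn C I) : 0 < evalR p β ↔ 0 ≤ β := by
  refine ⟨fun h => (nonneg_or_nonpos hC hβ.1).resolve_right fun h0 => ?_, fun h => (hp β hβ h).1⟩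
  have hneg : -β ∈ rootsIn C I := ⟨neg_mem_affRoots hβ.1, fun i hi => hβ.2 i (by simpa using hi)⟩
  have := (hp _ hneg (neg_nonneg.2 h0)).1
  rw [evalR_neg] at this
  linarith

theorem evalR_interior_ne_zero (hC : IsSimplyLacedAffine C m) {I : Set ι} {p : ι → ℝ}
    (hp : ∀ β ∈ rootsIn C I, 0 ≤ β → 0 < evalR p β ∧ evalR p β < 1) {β : ι → ℤ}
    (hβ : β ∈ rootsIn C I) : evalR p β ≠ 0 := by
  have hneg : -β ∈ rootsIn C I := ⟨neg_mem_affRoots hβ.1, fun i hi => hβ.2 i (by simpa using hi)⟩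
  rcases nonneg_or_nonpos hC hβ.1 with h | h
  · exact (hp β hβ h).1.ne'
  · have := (hp _ hneg (neg_nonneg.2 h)).1
    rw [evalR_neg] at this
    linarith

theorem omegaFin_le (J : Set ι) : omegaFin C J ≤ parabolic C J := fun _ h => h.1

theorem isInternalSemidirect_omega (hC : IsSimplyLacedAffine C m) {I : Set ι}
    (hI : IsProper C I) :
    IsInternalSemidirect (omegaHatSub C m I) (⨆ j : Comp C I, omegaFin C j.verts)
      (omegaHatSub C m I ⊔ ⨆ j : Comp C I, omegaFin C j.verts) where
  normalizes h hh n hn := by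
    have hf := (isAffineAut_of_mem hC hh.1.1).form
    have : ⨆ j : Comp C I, omegaFin C j.verts ≤
        (⨆ j : Comp C I, omegaFin C j.verts).comap (MulAut.conj h).toMonoidHom := by
      refine iSup_le fun j n hn => ?_
      obtain ⟨k, hjk, hkj⟩ := exists_comp_image_iff hC hf hh.2 j
      exact Subgroup.mem_iSup_of_mem k (conj_mem_omegaFin hC hf hjk hkj hn)
    exact this hn
  disjoint := by
    rw [Subgroup.disjoint_def]
    intro u hu hu'
    obtain ⟨p, hp⟩ := exists_interior_point hC hI
    have hpar : u ∈ parabolic C I :=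
      (iSup_le fun j => (omegaFin_le _).trans (parabolic_mono (verts_subset j)) :
        ⨆ j : Comp C I, omegaFin C j.verts ≤ parabolic C I) hu'
    -- A common element lies in W_I and permutes the simple roots in I, so it preserves the positive
    -- roots of the finite system.
    refine (isFiniteLaced_rootsIn hC hI).eq_one_of_pos hC.symm
      (fun β hβ => evalR_interior_ne_zero hC hp hβ) (parabolic_le_reflGroup hC I hpar) ?_
    intro β hβ hpos
    rw [evalR_pos_iff hC hp hβ] at hpos
    rw [evalR_pos_iff hC hp (parabolic_apply_mem_rootsIn hC hpar hβ)]
    exact apply_nonneg_of_stabilizes hu.2 hβ.2 hpos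
  sup_eq := rfl

/-! ### Stabilizers of points of the alcove -/

/-- Take l in the support of wαᵢ. Applying w⁻¹ expresses αᵢ as a nonnegative combination of the
positive roots w⁻¹αₖ, so w⁻¹αₗ is supported at i alone and equals αᵢ. -/
theorem apply_simpleRoot_of_nonneg (hC : IsSimplyLacedAffine C m) {w : LatAut ι}
    (hw : ∀ β ∈ affRoots C, w β ∈ affRoots C) (hw' : ∀ β ∈ affRoots C, w⁻¹ β ∈ affRoots C)
    (h0 : ∀ β ∈ affRoots C, 0 ≤ β → 0 ≤ w β) (h0' : ∀ β ∈ affRoots C, 0 ≤ β → 0 ≤ w⁻¹ β)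
    (i : ι) : ∃ l, w (simpleRoot i) = simpleRoot l := by
  have hsimple : ∀ l : ι, (0 : ι → ℤ) ≤ simpleRoot l := fun l => Pi.single_nonneg.2 zero_le_one
  have hwi := hw _ (simpleRoot_mem_affRoots hC i)
  have hwi0 := h0 _ (simpleRoot_mem_affRoots hC i) (hsimple i)
  obtain ⟨l, hl⟩ := Function.ne_iff.1 (affRoots_ne_zero hwi)
  have hlpos : 0 < w (simpleRoot i) l := lt_of_le_of_ne (hwi0 l) (Ne.symm hl)
  have hsum : simpleRoot i = ∑ k, w (simpleRoot i) k • w⁻¹ (simpleRoot k) := by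
    rw [← apply_eq_sum]
    exact (LinearEquiv.symm_apply_apply w _).symm
  have hl' := h0' _ (simpleRoot_mem_affRoots hC l) (hsimple l)
  refine ⟨l, ?_⟩
  have heq : w⁻¹ (simpleRoot l) = simpleRoot i := by
    refine eq_simpleRoot_of_support hC (hw' _ (simpleRoot_mem_affRoots hC l)) hl' fun k hk => ?_
    have h1 := congrFun hsum k
    rw [Finset.sum_apply] at h1
    have h2 : simpleRoot i k = 0 := by simp [simpleRoot, hk]
    rw [h2] at h1
    have h3 := (Finset.sum_eq_zero_iff_of_nonneg fun n _ => by
      have := h0' _ (simpleRoot_mem_affRoots hC n) (hsimple n) k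
      exact mul_nonneg (hwi0 n) this).1 h1.symm l (Finset.mem_univ l)
    exact (mul_eq_zero.1 h3).resolve_left hlpos.ne'
  rw [← heq]
  exact LinearEquiv.apply_symm_apply w _

theorem mem_rootsIn_of_eval_eq_zero (hC : IsSimplyLacedAffine C m) {x : ι → ℝ}
    (hx : ∀ i, 0 ≤ x i) {β : ι → ℤ} (hβ : β ∈ affRoots C) :
    evalR x β = 0 ↔ β ∈ rootsIn C {i | x i = 0} := by
  constructor
  · have key : ∀ β ∈ affRoots C, 0 ≤ β → evalR x β = 0 → ∀ i, β i ≠ 0 → x i = 0 := by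
      intro β _ h0 h i hi
      have := (Finset.sum_eq_zero_iff_of_nonneg fun k _ =>
        mul_nonneg (by exact_mod_cast h0 k) (hx k)).1 h i (Finset.mem_univ i)
      exact (mul_eq_zero.1 this).resolve_left (by exact_mod_cast hi)
    intro h
    refine ⟨hβ, ?_⟩
    rcases nonneg_or_nonpos hC hβ with h0 | h0
    · exact key β hβ h0 h
    · intro i hi
      exact key _ (neg_mem_affRoots hβ) (neg_nonneg.2 h0) (by rw [evalR_neg, h, neg_zero]) i
        (by simpa using hi)
  · intro h
    refine Finset.sum_eq_zero fun i _ => ?_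
    by_cases hi : β i = 0
    · simp [hi]
    · rw [show x i = 0 from h.2 i hi, mul_zero]

/-- The stabilizer of a point of the alcove is generated by diagram automorphisms and
a parabolic subgroup. -/
theorem exists_omegaHat_mul_parabolic (hC : IsSimplyLacedAffine C m) {x : ι → ℝ}
    (hx : ∀ i, 0 ≤ x i) (hI : IsProper C {i | x i = 0}) {w : LatAut ι} (hw : w ∈ extWeyl C m)
    (hwx : ∀ v, evalR x (w v) = evalR x v) :
    ∃ ω ∈ omegaHatSub C m {i | x i = 0}, ∃ u ∈ parabolic C {i | x i = 0}, w = ω * u := by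
  set I := {i | x i = 0} with hIdef
  have hR := isFiniteLaced_rootsIn hC hI
  obtain ⟨p, hp⟩ := exists_interior_point hC hI
  have hwaff := isAffineAut_of_mem hC hw
  obtain ⟨u, hu, hpos⟩ := hR.exists_mul_pos (v := p)
    (fun β hβ => evalR_interior_ne_zero hC hp hβ) (w := w) fun β hβ => by
      rw [← mem_rootsIn_of_eval_eq_zero hC hx (hwaff.apply_mem hβ.1), hwx,
        mem_rootsIn_of_eval_eq_zero hC hx hβ.1]
      exact hβ
  have hupar := reflGroup_le_parabolic hC hI hu
  set ω := w * u with hω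
  have hωmem : ω ∈ extWeyl C m := mul_mem hw (parabolic_le_extWeyl _ hupar)
  have hωaff := isAffineAut_of_mem hC hωmem
  have hωaff' := isAffineAut_of_mem hC (inv_mem hωmem)
  have hωx : ∀ v, evalR x (ω v) = evalR x v := fun v =>
    (hwx _).trans (evalR_parabolic hC hupar (fun i hi => hi) v)
  have hωinv : ∀ v, ω (ω⁻¹ v) = v := fun v => LinearEquiv.apply_symm_apply ω v
  have hωx' : ∀ v, evalR x (ω⁻¹ v) = evalR x v := fun v => by rw [← hωx, hωinv]
  have h0 : ∀ β ∈ affRoots C, 0 ≤ β → 0 ≤ ω β := by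
    intro β hβ hβ0
    -- Roots vanishing at x stay positive by the choice of u. For the others the sign is read off
    -- the value at x, which ω preserves.
    by_cases hβI : evalR x β = 0
    · have h1 := (mem_rootsIn_of_eval_eq_zero hC hx hβ).1 hβI
      have h2 : ω β ∈ rootsIn C I :=
        (mem_rootsIn_of_eval_eq_zero hC hx (hωaff.apply_mem hβ)).1 (by rw [hωx, hβI])
      exact (evalR_pos_iff hC hp h2).1 (hpos β h1 ((evalR_pos_iff hC hp h1).2 hβ0))
    · refine (nonneg_or_nonpos hC (hωaff.apply_mem hβ)).resolve_right fun h => ?_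
      have h1 := evalR_nonneg hx hβ0
      have h2 := evalR_nonneg hx (neg_nonneg.2 h)
      rw [evalR_neg, hωx] at h2
      exact hβI (by linarith)
  have h0' : ∀ β ∈ affRoots C, 0 ≤ β → 0 ≤ ω⁻¹ β := by
    intro β hβ hβ0
    refine (nonneg_or_nonpos hC (hωaff'.apply_mem hβ)).resolve_right fun h => ?_
    have := h0 _ (neg_mem_affRoots (hωaff'.apply_mem hβ)) (neg_nonneg.2 h)
    rw [map_neg, hωinv] at this
    exact affRoots_ne_zero hβ (le_antisymm (neg_nonneg.1 this) hβ0)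
  have halc : ∀ g ∈ extWeyl C m, (∀ β ∈ affRoots C, 0 ≤ β → 0 ≤ g⁻¹ β) → ∀ z ∈ alcove C m,
      actR g z ∈ alcove C m := by
    refine fun g hg hg0 z hz => ⟨fun c => by rw [evalR_actR_delta hC hg, hz.1], fun i => ?_⟩
    exact evalR_nonneg hz.2 (hg0 _ (simpleRoot_mem_affRoots hC i)
      (Pi.single_nonneg.2 zero_le_one))
  refine ⟨ω, ⟨⟨hωmem, Set.Subset.antisymm ?_ fun z hz => mem_actR_image.2 ?_⟩, ?_⟩, u⁻¹,
    inv_mem hupar, by rw [hω, mul_inv_cancel_right]⟩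
  · rintro _ ⟨z, hz, rfl⟩
    exact halc ω hωmem h0' z hz
  · exact halc ω⁻¹ (inv_mem hωmem) (by rwa [inv_inv]) z hz
  · refine MulAction.mem_stabilizer_iff.2 (Set.Subset.antisymm ?_ ?_)
    · rintro _ ⟨_, ⟨i, hi, rfl⟩, rfl⟩
      obtain ⟨l, hl⟩ := apply_simpleRoot_of_nonneg hC (fun β hβ => hωaff.apply_mem hβ)
        (fun β hβ => hωaff'.apply_mem hβ) h0 h0' i
      refine ⟨l, ?_, hl.symm⟩
      change x l = 0
      rw [← evalR_simpleRoot x l, ← hl, hωx, evalR_simpleRoot]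
      exact hi
    · rintro _ ⟨l, hl, rfl⟩
      obtain ⟨i, hi⟩ := apply_simpleRoot_of_nonneg hC (w := ω⁻¹)
        (fun β hβ => hωaff'.apply_mem hβ)
        (fun β hβ => by rw [inv_inv]; exact hωaff.apply_mem hβ) h0'
        (fun β hβ h => by rw [inv_inv]; exact h0 β hβ h) l
      refine ⟨simpleRoot i, ⟨i, ?_, rfl⟩, ?_⟩
      · change x i = 0
        rw [← evalR_simpleRoot x i, ← hi, hωx', evalR_simpleRoot]
        exact hl
      · change ω (simpleRoot i) = simpleRoot l
        rw [← hi, hωinv]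

/-! ### Stabilizers of root variables -/

theorem rootVar_sub (a : ι → ℂˣ) (u v : ι → ℤ) :
    rootVar a (u - v) = rootVar a u / rootVar a v := by
  simp [rootVar, zpow_sub, Finset.prod_mul_distrib, div_eq_mul_inv]

theorem rootVar_zsmul (a : ι → ℂˣ) (k : ℤ) (v : ι → ℤ) :
    rootVar a (k • v) = rootVar a v ^ k := by
  simp [rootVar, zpow_mul', Finset.prod_zpow]

/-- The roots supported in `I` whose root variable is `1`. -/
def unitRoots (C : Matrix ι ι ℤ) (a : ι → ℂˣ) (I : Set ι) : Set (ι → ℤ) :=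
  {β | β ∈ rootsIn C I ∧ rootVar a β = 1}

theorem isFiniteLaced_unitRoots (hC : IsSimplyLacedAffine C m) {I : Set ι} (hI : IsProper C I)
    (a : ι → ℂˣ) : IsFiniteLaced C (unitRoots C a I) where
  finite := (isFiniteLaced_rootsIn hC hI).finite.subset fun _ h => h.1
  norm β hβ := hβ.1.1.1
  reflect β hβ γ hγ := by
    refine ⟨reflection_mem_rootsIn hC hβ.1 hγ.1, ?_⟩
    rw [reflection_apply hβ.1.1.1, rootVar_sub, rootVar_zsmul, hβ.2, hγ.2]
    simp
  le_one β hβ γ hγ := (isFiniteLaced_rootsIn hC hI).le_one β hβ.1 γ hγ.1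

theorem iSup_unitReflGroup (hC : IsSimplyLacedAffine C m) {I : Set ι} (hI : IsProper C I)
    (a : ι → ℂˣ) :
    ⨆ j : Comp C I, unitReflGroup C a j.verts = reflGroup C (unitRoots C a I) := by
  refine le_antisymm (iSup_le fun j => Subgroup.closure_mono ?_) ?_
  · rintro s ⟨β, ⟨hβ, h1⟩, hs⟩
    exact ⟨β, ⟨(mem_rootsIn_iff hC hI).2 ⟨j, hβ⟩, h1⟩, hs⟩
  · refine reflGroup_le (isFiniteLaced_unitRoots hC hI a).norm fun β hβ => ?_
    obtain ⟨j, hj⟩ := (mem_rootsIn_iff hC hI).1 hβ.1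
    exact Subgroup.mem_iSup_of_mem j
      (Subgroup.subset_closure ⟨β, ⟨hj, hβ.2⟩, reflection_apply hβ.1.1.1⟩)

theorem unitReflGroup_le_parabolic (hC : IsSimplyLacedAffine C m) (a : ι → ℂˣ) (J : Set ι) :
    unitReflGroup C a J ≤ parabolic C J :=
  reflGroup_le (R := {β | β ∈ subRoots C J ∧ rootVar a β = 1})
    (fun _ hβ => (subRoots_subset hC J hβ.1).1.1) fun _ hβ => reflection_mem_parabolic hC hβ.1

theorem rootVar_apply_of_mem_stab {a : ι → ℂˣ} {w : LatAut ι} (hw : w ∈ stab C m a)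
    (v : ι → ℤ) : rootVar a (w v) = rootVar a v := by
  have h : act w⁻¹ a = a := (inv_mem hw).2
  conv_rhs => rw [← h]
  rw [rootVar_act, inv_inv]

theorem reflGroup_unitRoots_le_stab (hC : IsSimplyLacedAffine C m) {I : Set ι}
    (hI : IsProper C I) (a : ι → ℂˣ) : reflGroup C (unitRoots C a I) ≤ stab C m a := by
  refine reflGroup_le (isFiniteLaced_unitRoots hC hI a).norm fun β hβ => ⟨?_, ?_⟩
  · exact parabolic_le_extWeyl I (reflGroup_le_parabolic hC hI
      (reflection_mem_reflGroup hβ.1 hβ.1.1.1))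
  · funext i
    rw [act, reflection_inv hβ.1.1.1, reflection_apply hβ.1.1.1, rootVar_sub, rootVar_zsmul, hβ.2,
      rootVar_simpleRoot]
    simp

/-- The real points `x` and `y` are the (normalized) absolute values and the arguments of `a`. -/
def IsPolar (a : ι → ℂˣ) (x y : ι → ℝ) : Prop :=
  ∀ v, rootVar a v = 1 ↔ evalR x v = 0 ∧ ∃ k : ℤ, evalR y v = k

theorem IsPolar.of_mem_stab {a : ι → ℂˣ} {x y : ι → ℝ} (h : IsPolar a x y) {w : LatAut ι}
    (hw : w ∈ stab C m a) (v : ι → ℤ) :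
    evalR x (w v) = evalR x v ∧ ∃ k : ℤ, evalR y (w v) = evalR y v + k := by
  have h1 : rootVar a (w v - v) = 1 := by
    rw [rootVar_sub, rootVar_apply_of_mem_stab hw, div_self']
  obtain ⟨h2, k, hk⟩ := (h _).1 h1
  rw [evalR_sub] at h2 hk
  exact ⟨by linarith, k, by linarith⟩

/-- The elements of the stabilizer of `a` that preserve the positive system given by `v` in the
set `R`. -/
def posStab (C : Matrix ι ι ℤ) (m : ι → ℕ) (a : ι → ℂˣ) (R : Set (ι → ℤ)) (v : ι → ℝ) :
    Subgroup (LatAut ι) where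
  carrier := {w | w ∈ stab C m a ∧ ∀ β ∈ R,
    (w β ∈ R ∧ (0 < evalR v β → 0 < evalR v (w β))) ∧
    (w⁻¹ β ∈ R ∧ (0 < evalR v β → 0 < evalR v (w⁻¹ β)))}
  one_mem' := ⟨one_mem _, fun β hβ => ⟨⟨hβ, id⟩, ⟨hβ, id⟩⟩⟩
  mul_mem' := by
    rintro x y ⟨hx, hx'⟩ ⟨hy, hy'⟩
    refine ⟨mul_mem hx hy, fun β hβ => ?_⟩
    obtain ⟨⟨h1, h2⟩, -⟩ := hy' β hβ
    obtain ⟨⟨h3, h4⟩, -⟩ := hx' _ h1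
    obtain ⟨-, ⟨h5, h6⟩⟩ := hx' β hβ
    obtain ⟨-, ⟨h7, h8⟩⟩ := hy' _ h5
    rw [mul_inv_rev]
    exact ⟨⟨h3, fun h => h4 (h2 h)⟩, ⟨h7, fun h => h8 (h6 h)⟩⟩
  inv_mem' := by
    rintro x ⟨hx, hx'⟩
    refine ⟨inv_mem hx, fun β hβ => ?_⟩
    rw [inv_inv]
    exact (hx' β hβ).symm

/-! ### The stabilizer of a tuple in normal position -/

section Alcove

variable {x y p : ι → ℝ} {a : ι → ℂˣ}

theorem apply_mem_rootsIn_of_fix (hC : IsSimplyLacedAffine C m) (hx : ∀ i, 0 ≤ x i)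
    {w : LatAut ι} (hw : w ∈ extWeyl C m) (hwx : ∀ v, evalR x (w v) = evalR x v) {β : ι → ℤ}
    (hβ : β ∈ rootsIn C {i | x i = 0}) : w β ∈ rootsIn C {i | x i = 0} := by
  rw [← mem_rootsIn_of_eval_eq_zero hC hx ((isAffineAut_of_mem hC hw).apply_mem hβ.1), hwx,
    mem_rootsIn_of_eval_eq_zero hC hx hβ.1]
  exact hβ

theorem apply_mem_unitRoots (hC : IsSimplyLacedAffine C m) (hx : ∀ i, 0 ≤ x i)
    (ha : IsPolar a x y) {w : LatAut ι} (hw : w ∈ stab C m a) {β : ι → ℤ}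
    (hβ : β ∈ unitRoots C a {i | x i = 0}) : w β ∈ unitRoots C a {i | x i = 0} :=
  ⟨apply_mem_rootsIn_of_fix hC hx hw.1 (fun v => (ha.of_mem_stab hw v).1) hβ.1,
    by rw [rootVar_apply_of_mem_stab hw, hβ.2]⟩

theorem mem_unitRoots_of_int (hC : IsSimplyLacedAffine C m) (hx : ∀ i, 0 ≤ x i)
    (ha : IsPolar a x y) {β : ι → ℤ} (hβ : β ∈ rootsIn C {i | x i = 0}) {k : ℤ}
    (hk : evalR y β = k) : β ∈ unitRoots C a {i | x i = 0} :=
  ⟨hβ, (ha β).2 ⟨(mem_rootsIn_of_eval_eq_zero hC hx hβ.1).2 hβ, k, hk⟩⟩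

/-- The value at y is an integer, whereas the value at p lies strictly between 0 and 1 up to sign.
-/
theorem evalR_sub_ne_zero (hC : IsSimplyLacedAffine C m)
    (hp : ∀ β ∈ rootsIn C {i | x i = 0}, 0 ≤ β → 0 < evalR p β ∧ evalR p β < 1)
    (ha : IsPolar a x y) {β : ι → ℤ} (hβ : β ∈ unitRoots C a {i | x i = 0}) :
    evalR (p - y) β ≠ 0 := by
  intro h
  obtain ⟨-, k, hk⟩ := (ha β).1 hβ.2
  rw [evalR_sub_left, hk, sub_eq_zero] at h
  rcases nonneg_or_nonpos hC hβ.1.1 with h0 | h0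
  · obtain ⟨h1, h2⟩ := hp β hβ.1 h0
    rw [h] at h1 h2
    have h1 : 0 < k := by exact_mod_cast h1
    have h2 : k < 1 := by exact_mod_cast h2
    omega
  · have hneg : -β ∈ rootsIn C {i | x i = 0} :=
      ⟨neg_mem_affRoots hβ.1.1, fun i hi => hβ.1.2 i (by simpa using hi)⟩
    obtain ⟨h1, h2⟩ := hp _ hneg (neg_nonneg.2 h0)
    rw [evalR_neg, h] at h1 h2
    have h1 : 0 < -k := by exact_mod_cast h1
    have h2 : -k < 1 := by exact_mod_cast h2
    omega

/-- The stabilizer permutes the unit roots. Any of its elements can be corrected by their reflection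
group to preserve the positive system of p - y, and only the identity of that group preserves it. -/
theorem isInternalSemidirect_stab (hC : IsSimplyLacedAffine C m) (hx : ∀ i, 0 ≤ x i)
    (hI : IsProper C {i | x i = 0})
    (hp : ∀ β ∈ rootsIn C {i | x i = 0}, 0 ≤ β → 0 < evalR p β ∧ evalR p β < 1)
    (ha : IsPolar a x y) :
    IsInternalSemidirect (posStab C m a (unitRoots C a {i | x i = 0}) (p - y))
      (reflGroup C (unitRoots C a {i | x i = 0})) (stab C m a) := by
  have hR := isFiniteLaced_unitRoots hC hI a
  have hne : ∀ β ∈ unitRoots C a {i | x i = 0}, evalR (p - y) β ≠ 0 :=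
    fun β hβ => evalR_sub_ne_zero hC hp ha hβ
  refine ⟨fun w hw n hn => ?_, ?_, le_antisymm ?_ fun w hw => ?_⟩
  · exact conj_mem_reflGroup hR.norm (isAffineAut_of_mem hC hw.1.1).form
      (fun β hβ => (hw.2 β hβ).1.1) hn
  · rw [Subgroup.disjoint_def]
    exact fun hw hw' => hR.eq_one_of_pos hC.symm hne hw' fun β hβ => (hw.2 β hβ).1.2
  · exact sup_le (fun w hw => hw.1) (reflGroup_unitRoots_le_stab hC hI a)
  · obtain ⟨u, hu, hpos⟩ := hR.exists_mul_pos hne (w := w)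
      fun β hβ => apply_mem_unitRoots hC hx ha hw hβ
    have hwu : w * u ∈ stab C m a := mul_mem hw (reflGroup_unitRoots_le_stab hC hI a hu)
    rw [← mul_inv_cancel_right w u]
    refine mul_mem (Subgroup.mem_sup_left ⟨hwu, fun β hβ => ⟨⟨?_, hpos β hβ⟩, ?_, fun h => ?_⟩⟩)
      (Subgroup.mem_sup_right (inv_mem hu))
    · exact apply_mem_unitRoots hC hx ha hwu hβ
    · exact apply_mem_unitRoots hC hx ha (inv_mem hwu) hβ
    · have hmem := apply_mem_unitRoots hC hx ha (inv_mem hwu) hβ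
      by_contra hle
      have hlt : evalR (p - y) ((w * u)⁻¹ β) < 0 := lt_of_le_of_ne (not_lt.1 hle) (hne _ hmem)
      have := hpos _ (hR.neg_mem hmem) (by rw [evalR_neg]; linarith)
      rw [map_neg, show (w * u) ((w * u)⁻¹ β) = β from LinearEquiv.apply_symm_apply (w * u) β,
        evalR_neg] at this
      linarith

/-- An element preserving the positive system at `y` acts on the values at `y` by the carries of
a translated alcove. -/
theorem evalR_inv_apply_of_mem_posStab (hC : IsSimplyLacedAffine C m) (hx : ∀ i, 0 ≤ x i)
    (hp : ∀ β ∈ rootsIn C {i | x i = 0}, 0 ≤ β → 0 < evalR p β ∧ evalR p β < 1)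
    (hy : ∀ β ∈ rootsIn C {i | x i = 0}, 0 ≤ β → 0 ≤ evalR y β ∧ evalR y β ≤ 1)
    (ha : IsPolar a x y) {w : LatAut ι}
    (hw : w ∈ posStab C m a (unitRoots C a {i | x i = 0}) (p - y)) {β : ι → ℤ}
    (hβ : β ∈ rootsIn C {i | x i = 0}) (h0 : 0 ≤ β) :
    (0 ≤ w⁻¹ β → evalR y (w⁻¹ β) = evalR y β) ∧
      (w⁻¹ β ≤ 0 → evalR y (w⁻¹ β) = evalR y β - 1) := by
  have hfix := fun v => ha.of_mem_stab (inv_mem hw.1) v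
  have hγ : w⁻¹ β ∈ rootsIn C {i | x i = 0} :=
    apply_mem_rootsIn_of_fix hC hx (inv_mem hw.1.1) (fun v => (hfix v).1) hβ
  obtain ⟨k, hk⟩ := (hfix β).2
  obtain ⟨p0, p1⟩ := hp β hβ h0
  obtain ⟨y0, y1⟩ := hy β hβ h0
  have hww : w (w⁻¹ β) = β := LinearEquiv.apply_symm_apply w β
  -- When both values at y are integers, both roots are unit roots and p - y has the same sign on
  -- them. Each unwanted k below forces y to the ends of its range, making those signs opposite.
  have hfwd : ∀ {l n : ℤ}, evalR y β = l → evalR y (w⁻¹ β) = n →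
      (0 < evalR p (w⁻¹ β) - n ↔ 0 < evalR p β - l) := by
    intro l n hl hn
    have h1 := (hw.2 _ (mem_unitRoots_of_int hC hx ha hγ hn)).1.2
    have h2 := (hw.2 _ (mem_unitRoots_of_int hC hx ha hβ hl)).2.2
    rw [hww] at h1
    simp only [evalR_sub_left, hl, hn] at h1 h2
    exact ⟨h1, h2⟩
  constructor
  · intro hpos
    obtain ⟨q0, q1⟩ := hp _ hγ hpos
    obtain ⟨z0, z1⟩ := hy _ hγ hpos
    have hk1 : (-2 : ℝ) < k := by linarith
    have hk2 : (k : ℝ) < 2 := by linarith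
    have hk1 : -2 < k := by exact_mod_cast hk1
    have hk2 : k < 2 := by exact_mod_cast hk2
    obtain rfl | rfl | rfl : k = 0 ∨ k = 1 ∨ k = -1 := by omega
    · simpa using hk
    · push_cast at hk
      have := (hfwd (l := 0) (n := 1) (by push_cast; linarith) (by push_cast; linarith)).2
        (by push_cast; linarith)
      push_cast at this
      linarith
    · push_cast at hk
      have := (hfwd (l := 1) (n := 0) (by push_cast; linarith) (by push_cast; linarith)).1
        (by push_cast; linarith)
      push_cast at this
      linarith
  · intro hneg
    have hγ' : -w⁻¹ β ∈ rootsIn C {i | x i = 0} :=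
      ⟨neg_mem_affRoots hγ.1, fun i hi => hγ.2 i (by simpa using hi)⟩
    obtain ⟨q0, q1⟩ := hp _ hγ' (neg_nonneg.2 hneg)
    obtain ⟨z0, z1⟩ := hy _ hγ' (neg_nonneg.2 hneg)
    rw [evalR_neg] at q0 q1 z0 z1
    have hk1 : (-3 : ℝ) < k := by linarith
    have hk2 : (k : ℝ) < 1 := by linarith
    have hk1 : -3 < k := by exact_mod_cast hk1
    have hk2 : k < 1 := by exact_mod_cast hk2
    obtain rfl | rfl | rfl : k = -1 ∨ k = 0 ∨ k = -2 := by omega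
    · push_cast at hk
      linarith
    · push_cast at hk
      have := (hfwd (l := 0) (n := 0) (by push_cast; linarith) (by push_cast; linarith)).2
        (by push_cast; linarith)
      push_cast at this
      linarith
    · push_cast at hk
      have := (hfwd (l := 1) (n := -1) (by push_cast; linarith) (by push_cast; linarith)).1
        (by push_cast; linarith)
      push_cast at this
      linarith

theorem posStab_le (hC : IsSimplyLacedAffine C m) (hx : ∀ i, 0 ≤ x i)
    (hI : IsProper C {i | x i = 0})
    (hp : ∀ β ∈ rootsIn C {i | x i = 0}, 0 ≤ β → 0 < evalR p β ∧ evalR p β < 1)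
    (hy : ∀ β ∈ rootsIn C {i | x i = 0}, 0 ≤ β → 0 ≤ evalR y β ∧ evalR y β ≤ 1)
    (ha : IsPolar a x y) :
    posStab C m a (unitRoots C a {i | x i = 0}) (p - y) ≤
      omegaHatSub C m {i | x i = 0} ⊔ ⨆ j : Comp C {i | x i = 0}, omegaFin C j.verts := by
  intro w hw
  have hfix := fun v => (ha.of_mem_stab hw.1 v).1
  obtain ⟨ω, hω, u, hu, rfl⟩ := exists_omegaHat_mul_parabolic hC hx hI hw.1.1 hfix
  obtain ⟨f, hf, hfu, hK⟩ := exists_parabolic_decomposition hC hu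
  refine mul_mem (Subgroup.mem_sup_left hω) (Subgroup.mem_sup_right (hK _ fun j => ?_))
  refine Subgroup.mem_iSup_of_mem j
    -- On β this shift takes the value y(u⁻¹β) - y(ωβ). As u⁻¹β = w⁻¹(ωβ) and ωβ is again positive,
    -- it is the carry computed for ωβ.
    (mem_omegaFin_of_shift hC (hf j) (actR u y - actR ω⁻¹ y) fun β hβ h0 => ?_)
  have hβj := subRoots_subset hC _ hβ
  have hβI : β ∈ rootsIn C {i | x i = 0} := rootsIn_mono (verts_subset j) hβj
  have hωx : ∀ v, evalR x (ω v) = evalR x v := fun v => by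
    have h1 := hfix (u⁻¹ v)
    have h2 : (ω * u) (u⁻¹ v) = ω v := congrArg ω (LinearEquiv.apply_symm_apply u v)
    rw [h2, evalR_parabolic hC (inv_mem hu) (fun i hi => hi)] at h1
    exact h1
  have hωβ := apply_mem_rootsIn_of_fix hC hx hω.1.1 hωx hβI
  have hωβ0 := apply_nonneg_of_stabilizes hω.2 hβI.2 h0
  have key := evalR_inv_apply_of_mem_posStab hC hx hp hy ha hw hωβ hωβ0
  have hinv : (ω * u)⁻¹ (ω β) = u⁻¹ β := by
    rw [mul_inv_rev]
    exact congrArg (u⁻¹ : LatAut ι) (LinearEquiv.symm_apply_apply ω β)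
  rw [hinv] at key
  rw [← hfu j β hβj.2, evalR_sub_left, evalR_actR, evalR_actR, inv_inv]
  refine ⟨fun h => ?_, fun h => ?_⟩
  · rw [key.1 h, sub_self]
  · rw [key.2 h]
    ring

end Alcove

/-! ### Polar coordinates -/

/-- The principal logarithm of each aᵢ is Lxᵢ + 2πi yᵢ, so the variable of v is the exponential of L
x(v) + 2πi y(v), and exp is 1 exactly on 2πiℤ. -/
theorem isPolar_log_arg (a : ι → ℂˣ) {L : ℝ} (hL : L ≠ 0) :
    IsPolar a (fun i => Real.log ‖(a i : ℂ)‖ / L)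
      (fun i => Complex.arg (a i : ℂ) / (2 * Real.pi)) := by
  intro v
  set x : ι → ℝ := fun i => Real.log ‖(a i : ℂ)‖ / L with hx
  set y : ι → ℝ := fun i => Complex.arg (a i : ℂ) / (2 * Real.pi) with hy
  have hpi : (2 * Real.pi) ≠ 0 := by positivity
  have hai : ∀ i, (a i : ℂ) = Complex.exp ((L * x i : ℝ) + (2 * Real.pi * y i : ℝ) * Complex.I) := by
    intro i
    rw [← Complex.exp_log (a i).ne_zero]
    congr 1
    rw [hx, hy]
    simp only
    rw [mul_div_cancel₀ _ hL, mul_div_cancel₀ _ hpi, Complex.log]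
  have hexp : (rootVar a v : ℂ) =
      Complex.exp ((L * evalR x v : ℝ) + (2 * Real.pi * evalR y v : ℝ) * Complex.I) := by
    rw [rootVar, Units.coe_prod]
    simp only [Units.val_zpow_eq_zpow_val, hai, ← Complex.exp_int_mul]
    rw [← Complex.exp_sum]
    congr 1
    simp only [evalR, Finset.mul_sum, Complex.ofReal_sum, Finset.sum_mul]
    rw [← Finset.sum_add_distrib]
    refine Finset.sum_congr rfl fun i _ => ?_
    push_cast
    ring
  rw [← Units.val_inj, hexp, Units.val_one, Complex.exp_eq_one_iff]
  constructor
  · rintro ⟨n, hn⟩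
    have hre := congrArg Complex.re hn
    have him := congrArg Complex.im hn
    simp [hL] at hre him
    exact ⟨hre, n, mul_left_cancel₀ hpi (by linarith)⟩
  · rintro ⟨h1, k, hk⟩
    refine ⟨k, ?_⟩
    rw [h1, hk]
    push_cast
    ring

theorem evalR_log_div (a : ι → ℂˣ) (L : ℝ) (v : ι → ℤ) :
    evalR (fun i => Real.log ‖(a i : ℂ)‖ / L) v = Real.log ‖(rootVar a v : ℂ)‖ / L := by
  rw [rootVar, Units.coe_prod, norm_prod, Real.log_prod, Finset.sum_div]
  · refine Finset.sum_congr rfl fun i _ => ?_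
    rw [Units.val_zpow_eq_zpow_val, norm_zpow, Real.log_zpow]
    ring
  · exact fun i _ => norm_ne_zero_iff.2 (Units.ne_zero _)

theorem isProper_zeros {x : ι → ℝ} (hx : ∀ c, evalR x (delta C m c) = 1) :
    IsProper C {i | x i = 0} := by
  intro c
  by_contra! h
  have : evalR x (delta C m c) = 0 := by
    refine Finset.sum_eq_zero fun i _ => ?_
    by_cases hi : (dynkin C).connectedComponentMk i = c
    · rw [show x i = 0 from h i hi, mul_zero]
    · rw [delta, if_neg hi]
      simp
  rw [hx] at this
  exact one_ne_zero this

end AffineStab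

end


/-! ### The stabilizer theorem -/

open AffineStab in
theorem mainTheorem2 {ι : Type*} [Fintype ι] [DecidableEq ι]
    (C : Matrix ι ι ℤ) (m : ι → ℕ) (hC : IsSimplyLacedAffine C m)
    (a : ι → ℂˣ) (q : ℂˣ) (ha : ∀ c, rootVar a (delta C m c) = q) (hq : ‖(q : ℂ)‖ ≠ 1) :
    ∃ I : Set ι, ∃ g ∈ extWeyl C m, ∃ Ωa Wo ΩΦ M : Subgroup (LatAut ι),
      (∀ j : Comp C I, (subRoots C j.verts).Finite) ∧
      IsInternalProd (fun j : Comp C I => unitReflGroup C (act g a) j.verts) Wo ∧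
      IsInternalSemidirect Ωa Wo (stab C m (act g a)) ∧
      IsInternalProd (fun j : Comp C I => omegaFin C j.verts) ΩΦ ∧
      IsInternalSemidirect (omegaHatSub C m I) ΩΦ M ∧
      Ωa ≤ M := by
  have hL : Real.log ‖(q : ℂ)‖ ≠ 0 :=
    Real.log_ne_zero_of_pos_of_ne_one (norm_pos_iff.2 q.ne_zero) hq
  have hpolar := isPolar_log_arg a hL
  set x₀ : ι → ℝ := fun i => Real.log ‖(a i : ℂ)‖ / Real.log ‖(q : ℂ)‖ with hx₀
  set y₀ : ι → ℝ := fun i => Complex.arg (a i : ℂ) / (2 * Real.pi) with hy₀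
  have hδ : ∀ c, evalR x₀ (delta C m c) = 1 := fun c => by
    rw [hx₀, evalR_log_div, ha, div_self hL]
  obtain ⟨g, hg, hx⟩ := exists_actR_nonneg hC hδ
  set x := actR g x₀ with hxdef
  have hI : IsProper C {i | x i = 0} :=
    isProper_zeros (m := m) fun c => by rw [hxdef, evalR_actR_delta hC hg, hδ]
  obtain ⟨p, hp⟩ := exists_interior_point hC hI
  obtain ⟨u, hu, y, hyu, hy⟩ := exists_alcove_representative hC hI hp (actR g y₀)
  -- The factor u leaves x unchanged because x vanishes on I, and the integral shifts in y do not
  -- affect integrality.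
  have hpol : IsPolar (act (u * g) a) x y := by
    intro v
    obtain ⟨k, hk⟩ := hyu v
    rw [act_mul, rootVar_act, rootVar_act, hpolar, hk, ← evalR_actR g x₀, ← evalR_actR g y₀, ← hxdef,
      evalR_parabolic hC (inv_mem hu) (fun i hi => hi)]
    refine and_congr_right fun _ => ⟨?_, ?_⟩
    · rintro ⟨l, hl⟩
      exact ⟨l + k, by rw [hl]; push_cast; ring⟩
    · rintro ⟨l, hl⟩
      exact ⟨l - k, by push_cast; linarith⟩
  refine ⟨{i | x i = 0}, u * g, mul_mem (parabolic_le_extWeyl _ hu) hg, _, _, _, _, fun j => ?_,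
    isInternalProd_of_le_parabolic hC fun j => unitReflGroup_le_parabolic hC _ _, ?_,
    isInternalProd_of_le_parabolic hC fun j => omegaFin_le _, isInternalSemidirect_omega hC hI,
    posStab_le hC hx hI hp hy hpol⟩
  · exact (isFiniteLaced_rootsIn hC hI).finite.subset
      ((subRoots_subset hC _).trans (rootsIn_mono (verts_subset j)))
  · rw [iSup_unitReflGroup hC hI]
    exact isInternalSemidirect_stab hC hx hI hp hpol
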